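/- Let $\mathcal P\subset\mathbb R^2$ be a compact strictly convex set, symmetric with respect to the origin, whose boundary is a $C^\infty$ curve with strictly positive curvature. Write $[x,y]=x_1y_2-x_2y_1$, let $\mathcal Q=\{y\in\mathbb R^2 : [w,y]\le 1 \text{ for all } w\in\mathcal P\}$ be the dual unit ball, and for a closed curve $\gamma$ let $L_{\mathcal Q}=L_{\mathcal Q}(\gamma)$ be its length with respect to the norm whose unit ball is $\mathcal Q$. Let $\gamma$ be a smooth (i.e. $C^\infty$ and regular), simple, closed, strictly convex curve in the plane. Let $A$ be the usual area of the closed region enclosed by $\gamma$, let $A(\mathcal P)$ be the usual area of $\mathcal P$, and let $r_{\mathrm{in}}$ be the radius of the biggest inscribed $\mathcal P$-circle of $\gamma$, that is, the largest $r\ge 0$ such that some translate of $r\mathcal P$ is contained in the closed region enclosed by $\gamma$. Then $$ r_{\mathrm{in}}L_{\mathcal Q}-A-A(\mathcal P)\,r_{\mathrm{in}}^2=0 $$ if and only if $\gamma$ is homothetic to the unit $\mathcal P$-circle, i.e. the trace of $\gamma$ is $x+t\,\partial\mathcal P$ for some $x\in\mathbb R^2$ and $t>0$. -/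

import Mathlib

open Set Function Real MeasureTheory
open scoped Pointwise ContDiff

namespace MinkowskiPlane

/-- The plane `ℝ²`; its `volume` is the usual area. -/
abbrev Plane : Type := EuclideanSpace ℝ (Fin 2)

/-- The determinant `[x, y]` of two vectors of the plane. -/
def bracket (x y : Plane) : ℝ := x 0 * y 1 - x 1 * y 0

/-- The vector `e_θ = (-sin θ, cos θ)`. -/
noncomputable def eTheta (θ : ℝ) : Plane := !₂[-Real.sin θ, Real.cos θ]

/-- The usual area of a set. -/
noncomputable def area (S : Set Plane) : ℝ := volume.real S

/-- `P` is a compact strictly convex set, symmetric with respect to the origin, whose boundary is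
a smooth closed curve `p` of strictly positive curvature, written in the parametrization in which
the tangent vector `p' θ` is a positive multiple of `e_θ` (so that `θ` is the angle of the outer
normal). The positivity of the multiple is the positivity of the curvature. -/
structure IsSmoothUnitBall (P : Set Plane) : Prop where
  isCompact : IsCompact P
  strictConvex : StrictConvex ℝ P
  symmetric : ∀ x ∈ P, -x ∈ P
  boundary : ∃ p : ℝ → Plane, ContDiff ℝ ∞ p ∧ Periodic p (2 * π) ∧ range p = frontier P ∧
    ∀ θ, ∃ c : ℝ, 0 < c ∧ deriv p θ = c • eTheta θ

/-- The dual unit ball `Q` of `P`, where a vector `y` is identified with the linear functional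
`w ↦ [w, y]`. -/
def dualBall (P : Set Plane) : Set Plane := {y | ∀ w ∈ P, bracket w y ≤ 1}

/-- The length of the closed curve `γ` (of period `2π`) in the norm whose unit ball is `Q`. -/
noncomputable def length (Q : Set Plane) (γ : ℝ → Plane) : ℝ :=
  ∫ u in (0 : ℝ)..(2 * π), gauge Q (deriv γ u)

/-- The closed region enclosed by a closed convex curve: the convex hull of its trace. -/
def region (γ : ℝ → Plane) : Set Plane := convexHull ℝ (range γ)

/-- `γ` is a smooth (that is, `C^∞` and regular), simple, closed, strictly convex curve: it runs
once around the boundary of the strictly convex region that it encloses. -/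
structure IsStrictlyConvexCurve (γ : ℝ → Plane) : Prop where
  smooth : ContDiff ℝ ∞ γ
  closed : Periodic γ (2 * π)
  regular : ∀ u, deriv γ u ≠ 0
  simple : InjOn γ (Ico 0 (2 * π))
  strictConvex : StrictConvex ℝ (region γ)
  boundary : frontier (region γ) = range γ

/-- The radius of the biggest `P`-ball `x + r P` contained in `D`. -/
noncomputable def inradius (P D : Set Plane) : ℝ :=
  sSup {r : ℝ | 0 ≤ r ∧ ∃ x : Plane, x +ᵥ r • P ⊆ D}

/-- The set `C` is homothetic to the unit `P`-circle, the boundary of `P`. -/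
def IsHomotheticToCircle (P C : Set Plane) : Prop :=
  ∃ (x : Plane) (t : ℝ), 0 < t ∧ C = x +ᵥ t • frontier P

end MinkowskiPlane

/-! Let `K` be the region and `x + r P` a copy of the ball. Since `bracket z (eTheta θ)` is the
scalar product of `z` with the unit vector of angle `θ`, it yields support functions. Compare the
points of the two boundaries with the same outer normal angle `θ`: the difference `h` of support
functions (`normalGap`) satisfies `dh = k dθ` with `k` the tangential difference (`tangentGap`). Up
to the differential of a periodic function, `r L - A - A(P) r²` is then `1/2 ∫ (k² - h²) dθ`, for
every `x` and `r` (`bonnesen_eq`).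

If `r` is the inradius and `x + r P ⊆ K`, then `h ≥ 0`, and the zeros of `h` meet every closed half
circle of normals; otherwise the copy could be moved and enlarged (`exists_contact`). Hence the
zeros cut the circle into at most three arcs of length at most `π` (`exists_three_arcs`), and
Wirtinger's inequality makes the integral nonnegative on each. If the total vanishes, `h = C cos (θ
- m)` on each nondegenerate arc. By strict convexity the two boundary points coincide at a contact,
so `k` vanishes there too, which forces `C = 0` even on an arc of length exactly `π`. Thus `h = 0`,
all gaps close, and the curve is the boundary of `x + r P`.

Conversely, for a homothetic curve all gaps are zero. The curvature of `γ` may vanish at points, so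
`θ` need not be a smooth parameter: integrals run over the parameter `u` of the curve, with `dθ = θ'
du`, `θ` strictly increasing and `θ' ≥ 0`. -/

namespace MinkowskiPlane

/-! ### The determinant and the tangent directions -/

section Bracket

theorem bracket_add_left (x y z : Plane) : bracket (x + y) z = bracket x z + bracket y z := by
  simp [bracket]; ring

theorem bracket_sub_left (x y z : Plane) : bracket (x - y) z = bracket x z - bracket y z := by
  simp [bracket]; ring

theorem bracket_smul_left (t : ℝ) (x y : Plane) : bracket (t • x) y = t * bracket x y := by
  simp [bracket]; ring

theorem bracket_neg_left (x y : Plane) : bracket (-x) y = -bracket x y := by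
  simp [bracket]; ring

theorem bracket_smul_right (t : ℝ) (x y : Plane) : bracket x (t • y) = t * bracket x y := by
  simp [bracket]; ring

theorem bracket_neg_right (x y : Plane) : bracket x (-y) = -bracket x y := by
  simp [bracket]; ring

@[fun_prop]
theorem continuous_apply_fin {X : Type*} [TopologicalSpace X] {f : X → Plane} (hf : Continuous f)
    (i : Fin 2) : Continuous fun x => f x i :=
  (EuclideanSpace.proj (𝕜 := ℝ) i).continuous.comp hf

@[fun_prop]
theorem continuous_bracket {X : Type*} [TopologicalSpace X] {f g : X → Plane} (hf : Continuous f)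
    (hg : Continuous g) : Continuous fun x => bracket (f x) (g x) := by
  unfold bracket; fun_prop

@[fun_prop]
theorem continuous_eTheta {X : Type*} [TopologicalSpace X] {f : X → ℝ} (hf : Continuous f) :
    Continuous fun x => eTheta (f x) := by
  unfold eTheta
  refine (PiLp.continuous_toLp 2 _).comp (continuous_pi fun i => ?_)
  fin_cases i <;> simp <;> fun_prop

@[simp] theorem eTheta_zero (θ : ℝ) : eTheta θ 0 = -Real.sin θ := rfl

@[simp] theorem eTheta_one (θ : ℝ) : eTheta θ 1 = Real.cos θ := rfl

theorem eTheta_ne_zero (θ : ℝ) : eTheta θ ≠ 0 := by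
  intro h
  have h0 := congrArg (fun v : Plane => v 0) h
  have h1 := congrArg (fun v : Plane => v 1) h
  simp at h0 h1
  nlinarith [Real.sin_sq_add_cos_sq θ]

theorem bracket_eTheta_eTheta (φ θ : ℝ) :
    bracket (eTheta φ) (eTheta θ) = Real.sin (θ - φ) := by
  simp [bracket, Real.sin_sub]; ring

theorem hasDerivAt_apply {f : ℝ → Plane} {f' : Plane} {u : ℝ} (hf : HasDerivAt f f' u)
    (i : Fin 2) : HasDerivAt (fun s => f s i) (f' i) u :=
  (EuclideanSpace.proj (𝕜 := ℝ) i).hasFDerivAt.comp_hasDerivAt u hf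

theorem hasDerivAt_bracket_const {f : ℝ → Plane} {f' : Plane} {u : ℝ} (hf : HasDerivAt f f' u)
    (w : Plane) : HasDerivAt (fun s => bracket (f s) w) (bracket f' w) u := by
  unfold bracket
  exact ((hasDerivAt_apply hf 0).mul_const _).sub ((hasDerivAt_apply hf 1).mul_const _)

theorem exists_bracket_eq (f : StrongDual ℝ Plane) : ∃ w : Plane, ∀ y, f y = bracket y w := by
  refine ⟨!₂[-f (EuclideanSpace.single 1 1), f (EuclideanSpace.single 0 1)], fun y => ?_⟩
  have hy : y = y 0 • EuclideanSpace.single (0 : Fin 2) (1 : ℝ) +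
      y 1 • EuclideanSpace.single (1 : Fin 2) (1 : ℝ) := by
    ext i; fin_cases i <;> simp
  conv_lhs => rw [hy]
  simp [bracket]

theorem exists_smul_of_bracket_eq_zero {v w : Plane} (hv : v ≠ 0) (h : bracket v w = 0) :
    ∃ c : ℝ, w = c • v := by
  have hn : v 0 ^ 2 + v 1 ^ 2 ≠ 0 := by
    intro h0
    apply hv
    ext i
    fin_cases i <;> simp <;> nlinarith [sq_nonneg (v 0), sq_nonneg (v 1)]
  refine ⟨(v 0 * w 0 + v 1 * w 1) / (v 0 ^ 2 + v 1 ^ 2), ?_⟩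
  unfold bracket at h
  ext i
  fin_cases i
  · simp only [PiLp.smul_apply, smul_eq_mul, Fin.zero_eta]
    field_simp
    linear_combination -(v 1) * h
  · simp only [PiLp.smul_apply, smul_eq_mul, Fin.mk_one]
    field_simp
    linear_combination (v 0) * h

end Bracket

/-! ### Support lines of convex sets -/

section Convex

variable {K : Set Plane}

/-- A nonzero linear functional has no maximum at an interior point: `v` is `w` turned by a right
angle, so that `[v, w] = |w|²`. -/
theorem exists_bracket_lt_of_mem_interior {o w : Plane} (ho : o ∈ interior K) (hw : w ≠ 0) :
    ∃ z ∈ K, bracket o w < bracket z w := by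
  set v : Plane := !₂[w 1, -w 0] with hv
  have hvw : 0 < bracket v w := by
    have h1 : bracket v w = w 1 ^ 2 + w 0 ^ 2 := by simp [bracket, hv]; ring
    rw [h1]
    by_contra hcon
    apply hw
    ext i
    fin_cases i <;> simp <;> nlinarith [sq_nonneg (w 0), sq_nonneg (w 1)]
  have hc : Continuous fun t : ℝ => o + t • v := by fun_prop
  have hmem : ∀ᶠ t in nhds (0 : ℝ), o + t • v ∈ K :=
    hc.continuousAt (by simpa using mem_interior_iff_mem_nhds.1 ho)
  obtain ⟨ε, hε, h⟩ := Metric.eventually_nhds_iff.1 hmem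
  refine ⟨o + (ε / 2) • v, h ?_, ?_⟩
  · simp [abs_of_pos hε, hε]
  · rw [bracket_add_left, bracket_smul_left]
    have : 0 < ε / 2 * bracket v w := by positivity
    linarith

/-- The midpoint of two maximizers would be an interior maximizer. -/
theorem eq_of_bracket_maximal (hK : StrictConvex ℝ K) {w y z : Plane} (hw : w ≠ 0) (hy : y ∈ K)
    (hz : z ∈ K) (hmax : ∀ x ∈ K, bracket x w ≤ bracket y w) (hyz : bracket z w = bracket y w) :
    z = y := by
  by_contra hne
  have hmid := hK hz hy hne (a := 1 / 2) (b := 1 / 2) (by norm_num) (by norm_num) (by norm_num)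
  obtain ⟨x, hx, hlt⟩ := exists_bracket_lt_of_mem_interior hmid hw
  have := hmax x hx
  rw [bracket_add_left, bracket_smul_left, bracket_smul_left] at hlt
  linarith

theorem preimage_add_interior_mem_nhds {o : Plane} (ho : o ∈ interior K) :
    (fun z => z + o) ⁻¹' K ∈ nhds (0 : Plane) := by
  have hc : Continuous fun z : Plane => z + o := by fun_prop
  exact hc.continuousAt (by simpa using mem_interior_iff_mem_nhds.1 ho)

theorem frontier_preimage_add (o : Plane) :
    frontier ((fun z => z + o) ⁻¹' K) = (fun z => z + o) ⁻¹' frontier K :=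
  ((Homeomorph.addRight o).preimage_frontier K).symm

theorem convex_preimage_add (hK : Convex ℝ K) (o : Plane) :
    Convex ℝ ((fun z => z + o) ⁻¹' K) := hK.translate_preimage_left o

theorem isCompact_preimage_add (hK : IsCompact K) (o : Plane) :
    IsCompact ((fun z => z + o) ⁻¹' K) := (Homeomorph.addRight o).isCompact_preimage.2 hK

theorem gauge_pos_of_isCompact (hK : IsCompact K) (h0 : K ∈ nhds 0) {z : Plane} (hz : z ≠ 0) :
    0 < gauge K z :=
  (gauge_pos (absorbent_nhds_zero h0)
    ((NormedSpace.isVonNBounded_iff ℝ).2 hK.isBounded)).2 hz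

theorem inv_gauge_smul_mem_frontier (hc : Convex ℝ K) (hK : IsCompact K) (h0 : K ∈ nhds 0)
    {z : Plane} (hz : z ≠ 0) : (gauge K z)⁻¹ • z ∈ frontier K := by
  have hp := gauge_pos_of_isCompact hK h0 hz
  rw [← gauge_eq_one_iff_mem_frontier hc h0, gauge_smul_of_nonneg (by positivity), smul_eq_mul,
    inv_mul_cancel₀ hp.ne']

/-- The tangent line at a point of the boundary of a convex set is a support line. -/
theorem exists_tangent_support (hc : Convex ℝ K) (hcl : IsClosed K) {γ : ℝ → Plane}
    (hγK : ∀ u, γ u ∈ frontier K) {u : ℝ} {γ' : Plane} (hd : HasDerivAt γ γ' u) (hne : γ' ≠ 0)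
    {o : Plane} (ho : o ∈ interior K) :
    ∃ c : ℝ, c ≠ 0 ∧ (∀ z ∈ K, 0 ≤ c * bracket (γ u - z) γ') ∧
      ∀ z ∈ interior K, 0 < c * bracket (γ u - z) γ' := by
  have hnot : γ u ∉ interior K := fun h => (hγK u).2 h
  obtain ⟨f, hf⟩ := geometric_hahn_banach_open_point hc.interior isOpen_interior hnot
  obtain ⟨w, hw⟩ := exists_bracket_eq f
  have hle : ∀ z ∈ K, f z ≤ f (γ u) := by
    intro z hz
    have hz' : z ∈ closure (interior K) := by
      rw [hc.closure_interior_eq_closure_of_nonempty_interior ⟨o, ho⟩]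
      exact subset_closure hz
    exact closure_minimal (fun a ha => (hf a ha).le)
      (isClosed_le f.continuous continuous_const) hz'
  -- Along the curve the separating functional is maximal at `u`, so it kills the tangent; hence it
  -- is a multiple of the bracket with `γ'`.
  have hloc : IsLocalMax (fun s => f (γ s)) u :=
    Filter.Eventually.of_forall fun s => hle _ (hcl.frontier_subset (hγK s))
  have h0 : f γ' = 0 := hloc.hasDerivAt_eq_zero (f.hasFDerivAt.comp_hasDerivAt u hd)
  rw [hw] at h0
  obtain ⟨c, rfl⟩ := exists_smul_of_bracket_eq_zero hne h0
  have hfz : ∀ z, c * bracket (γ u - z) γ' = f (γ u) - f z := by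
    intro z
    rw [hw, hw, bracket_sub_left, bracket_smul_right, bracket_smul_right]; ring
  refine ⟨c, ?_, fun z hz => ?_, fun z hz => ?_⟩
  · rintro rfl
    have := hf o ho
    rw [hw, hw] at this
    simp [bracket] at this
  · rw [hfz]; linarith [hle z hz]
  · rw [hfz]; linarith [hf z hz]

/-- A convex body is the intersection of its half planes of support along a boundary curve. -/
theorem mem_of_forall_bracket_le (hc : Convex ℝ K) (hK : IsCompact K) {γ : ℝ → Plane}
    (hγK : range γ = frontier K) {o : Plane} (ho : o ∈ interior K) {n : ℝ → Plane}
    (hpos : ∀ u, 0 < bracket (γ u - o) (n u)) {z : Plane}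
    (hz : ∀ u, bracket z (n u) ≤ bracket (γ u) (n u)) : z ∈ K := by
  by_contra hzK
  set K' := (fun z => z + o) ⁻¹' K with hK'
  have hc' : Convex ℝ K' := convex_preimage_add hc o
  have hcomp' : IsCompact K' := isCompact_preimage_add hK o
  have h0 : K' ∈ nhds 0 := preimage_add_interior_mem_nhds ho
  have hzo : z - o ≠ 0 := fun h => hzK (by
    rw [sub_eq_zero.1 h]; exact interior_subset ho)
  have hg : 1 < gauge K' (z - o) := by
    by_contra hle
    have := (gauge_le_one_iff_mem_closure hc' h0).1 (not_lt.1 hle)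
    rw [hcomp'.isClosed.closure_eq] at this
    exact hzK (by simpa [hK'] using this)
  -- The segment from `o` to a point `z` outside `K` crosses the boundary at some `γ u`, and the
  -- inequality for `z` fails at this `u`.
  have hfr := inv_gauge_smul_mem_frontier hc' hcomp' h0 hzo
  rw [frontier_preimage_add, mem_preimage, ← hγK] at hfr
  obtain ⟨u, hu⟩ := hfr
  have hgo : γ u - o = (gauge K' (z - o))⁻¹ • (z - o) := by rw [hu]; simp
  have h1 := hpos u
  have h2 := hz u
  have h3 : bracket (z - o) (n u) = gauge K' (z - o) * bracket (γ u - o) (n u) := by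
    rw [hgo, bracket_smul_left, ← mul_assoc, mul_inv_cancel₀ (by linarith), one_mul]
  have h4 : bracket (z - o) (n u) = bracket z (n u) - bracket o (n u) := bracket_sub_left _ _ _
  have h5 : bracket (γ u - o) (n u) = bracket (γ u) (n u) - bracket o (n u) :=
    bracket_sub_left _ _ _
  nlinarith

/-- A curve with a nonzero velocity has two distinct points, and their midpoint is interior. -/
theorem interior_nonempty_of_range_subset (hK : StrictConvex ℝ K) {γ : ℝ → Plane}
    (hγK : ∀ u, γ u ∈ K) {u : ℝ} {γ' : Plane} (hd : HasDerivAt γ γ' u) (hne : γ' ≠ 0) :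
    (interior K).Nonempty := by
  by_contra hemp
  have hconst : ∀ s, γ s = γ u := by
    intro s
    by_contra hsu
    exact hemp ⟨_, hK (hγK s) (hγK u) hsu (a := 1 / 2) (b := 1 / 2) (by norm_num) (by norm_num)
      (by norm_num)⟩
  have : γ = fun _ => γ u := funext hconst
  rw [this] at hd
  exact hne (hd.unique (hasDerivAt_const _ _))

end Convex

/-! ### Area enclosed by a boundary curve -/

section Area

variable {K : Set Plane} {γ γ' : ℝ → Plane}

/-- The coordinates of a point of the plane, as a measurable equivalence. -/
noncomputable def coordEquiv : Plane ≃ᵐ ℝ × ℝ :=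
  (MeasurableEquiv.toLp 2 (Fin 2 → ℝ)).symm.trans MeasurableEquiv.finTwoArrow

theorem coordEquiv_apply (z : Plane) : coordEquiv z = (z 0, z 1) := rfl

theorem measurePreserving_coordEquiv : MeasurePreserving coordEquiv volume volume :=
  (volume_preserving_finTwoArrow ℝ).comp
    (EuclideanSpace.volume_preserving_symm_measurableEquiv_toLp (Fin 2))

/-- The map `(t, u) ↦ t γ(u)` in coordinates. -/
def coneMap (γ : ℝ → Plane) (q : ℝ × ℝ) : ℝ × ℝ := (q.1 * γ q.2 0, q.1 * γ q.2 1)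

/-- The derivative of `coneMap`. -/
noncomputable def coneMapDeriv (γ γ' : ℝ → Plane) (q : ℝ × ℝ) : ℝ × ℝ →L[ℝ] ℝ × ℝ :=
  (Matrix.toLin (.finTwoProd ℝ) (.finTwoProd ℝ)
    !![γ q.2 0, q.1 * γ' q.2 0; γ q.2 1, q.1 * γ' q.2 1]).toContinuousLinearMap

theorem hasFDerivAt_coneMap (hd : ∀ u, HasDerivAt γ (γ' u) u) (q : ℝ × ℝ) :
    HasFDerivAt (coneMap γ) (coneMapDeriv γ γ' q) q := by
  unfold coneMapDeriv
  rw [Matrix.toLin_finTwoProd_toContinuousLinearMap]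
  convert!
    HasFDerivAt.prodMk (𝕜 := ℝ)
      (hasFDerivAt_fst.mul ((hasDerivAt_apply (hd q.2) 0).comp_hasFDerivAt q hasFDerivAt_snd))
      (hasFDerivAt_fst.mul ((hasDerivAt_apply (hd q.2) 1).comp_hasFDerivAt q hasFDerivAt_snd))
    using 2 <;>
  simp [smul_smul, add_comm]

theorem det_coneMapDeriv (q : ℝ × ℝ) :
    (coneMapDeriv γ γ' q).det = q.1 * bracket (γ q.2) (γ' q.2) := by
  simp only [coneMapDeriv, LinearMap.det_toContinuousLinearMap, LinearMap.det_toLin,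
    Matrix.det_fin_two_of, bracket]
  ring

/-- Generalized polar coordinates: `(t, u) ↦ t γ(u)` is a bijection from `(0, 1] × [0, 2π)` onto `K
\ {0}`, with `t` recovered as the gauge, and its Jacobian is `t [γ, γ']`. -/
theorem area_eq_of_mem_nhds_zero (hc : Convex ℝ K) (hK : IsCompact K) (h0 : K ∈ nhds 0)
    (hd : ∀ u, HasDerivAt γ (γ' u) u) (hinj : InjOn γ (Ico 0 (2 * π)))
    (hfr : γ '' Ico 0 (2 * π) = frontier K)
    (hpos : ∀ u, 0 ≤ bracket (γ u) (γ' u)) :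
    area K = 1 / 2 * ∫ u in (0 : ℝ)..(2 * π), bracket (γ u) (γ' u) := by
  set s : Set (ℝ × ℝ) := Ioc 0 1 ×ˢ Ico 0 (2 * π) with hs
  have hsm : MeasurableSet s := measurableSet_Ioc.prod measurableSet_Ico
  have hg1 : ∀ u ∈ Ico 0 (2 * π), gauge K (γ u) = 1 := fun u hu =>
    (gauge_eq_one_iff_mem_frontier hc h0).2 (hfr ▸ mem_image_of_mem γ hu)
  have hcone : ∀ q : ℝ × ℝ, coneMap γ q = coordEquiv (q.1 • γ q.2) := fun q => by
    simp [coneMap, coordEquiv_apply]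
  have hinj' : InjOn (coneMap γ) s := by
    rintro ⟨t, u⟩ ⟨ht, hu⟩ ⟨t', u'⟩ ⟨ht', hu'⟩ h
    rw [hcone, hcone] at h
    have h1 : t • γ u = t' • γ u' := coordEquiv.injective h
    have h2 := congrArg (gauge K) h1
    simp only at ht ht' hu hu'
    rw [gauge_smul_of_nonneg ht.1.le, gauge_smul_of_nonneg ht'.1.le, hg1 u hu, hg1 u' hu'] at h2
    simp only [smul_eq_mul, mul_one] at h2
    subst h2
    have h3 := hinj hu hu' (smul_right_injective _ ht.1.ne' h1)
    rw [h3]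
  have himg : coordEquiv ⁻¹' (coneMap γ '' s) = K \ {0} := by
    ext z
    simp only [mem_preimage, mem_image, mem_sdiff, mem_singleton_iff]
    constructor
    · rintro ⟨⟨t, u⟩, ⟨ht, hu⟩, h⟩
      rw [hcone] at h
      have h1 : t • γ u = z := coordEquiv.injective h
      simp only at ht hu
      have h2 : gauge K z = t := by
        rw [← h1, gauge_smul_of_nonneg ht.1.le, hg1 u hu, smul_eq_mul, mul_one]
      constructor
      · rw [← hK.isClosed.closure_eq, ← gauge_le_one_iff_mem_closure hc h0, h2]
        exact ht.2
      · rintro rfl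
        rw [gauge_zero] at h2
        exact ht.1.ne h2
    · rintro ⟨hz, hz0⟩
      have hp := gauge_pos_of_isCompact hK h0 hz0
      have hfz := inv_gauge_smul_mem_frontier hc hK h0 hz0
      rw [← hfr] at hfz
      obtain ⟨u, hu, huz⟩ := hfz
      refine ⟨(gauge K z, u), ⟨⟨hp, gauge_le_one_of_mem hz⟩, hu⟩, ?_⟩
      rw [hcone]
      simp only [huz, smul_smul, mul_inv_cancel₀ hp.ne', one_smul]
  have hvol : area K = volume.real (coneMap γ '' s) := by
    unfold area Measure.real
    rw [← measurePreserving_coordEquiv.measure_preimage_equiv, himg,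
      measure_sdiff_null (measure_singleton _)]
  have hcv := integral_image_eq_integral_abs_det_fderiv_smul volume hsm
    (fun q _ => (hasFDerivAt_coneMap hd q).hasFDerivWithinAt) hinj' (fun _ => (1 : ℝ))
  rw [hvol]
  calc volume.real (coneMap γ '' s) = ∫ _ in coneMap γ '' s, (1 : ℝ) := by simp
    _ = ∫ q in s, q.1 * bracket (γ q.2) (γ' q.2) := by
      rw [hcv]
      refine setIntegral_congr_fun hsm fun q hq => ?_
      simp only [det_coneMapDeriv, smul_eq_mul, mul_one]
      exact abs_of_nonneg (mul_nonneg hq.1.1.le (hpos _))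
    _ = (∫ t in Ioc (0 : ℝ) 1, t) * ∫ u in Ico 0 (2 * π), bracket (γ u) (γ' u) :=
      setIntegral_prod_mul (fun t : ℝ => t) (fun u => bracket (γ u) (γ' u)) _ _
    _ = _ := by
      rw [← intervalIntegral.integral_of_le zero_le_one, integral_id, integral_Ico_eq_integral_Ioo,
        ← integral_Ioc_eq_integral_Ioo, ← intervalIntegral.integral_of_le (by positivity)]
      norm_num

theorem area_preimage_add (o : Plane) : area ((fun z => z + o) ⁻¹' K) = area K := by
  unfold area Measure.real
  rw [measure_preimage_add_right]

/-- The area of a convex body in terms of a positively oriented parametrization of its boundary. -/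
theorem area_eq_integral_bracket (hc : Convex ℝ K) (hK : IsCompact K)
    (hd : ∀ u, HasDerivAt γ (γ' u) u) (hcont : Continuous γ') (hper : Periodic γ (2 * π))
    (hinj : InjOn γ (Ico 0 (2 * π))) (hfr : range γ = frontier K) {o : Plane}
    (ho : o ∈ interior K) (hpos : ∀ u, 0 ≤ bracket (γ u - o) (γ' u)) (x : Plane) :
    area K = 1 / 2 * ∫ u in (0 : ℝ)..(2 * π), bracket (γ u - x) (γ' u) := by
  have hγ : Continuous γ := continuous_iff_continuousAt.2 fun u => (hd u).continuousAt
  have hfr' : γ '' Ico 0 (2 * π) = frontier K := by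
    rw [← hfr]
    refine Subset.antisymm (image_subset_range _ _) ?_
    rintro _ ⟨u, rfl⟩
    obtain ⟨v, hv, h⟩ := hper.exists_mem_Ico₀ (by positivity) u
    exact ⟨v, hv, h.symm⟩
  rw [← area_preimage_add o, area_eq_of_mem_nhds_zero (γ := fun u => γ u - o) (γ' := γ')
    (convex_preimage_add hc o) (isCompact_preimage_add hK o) (preimage_add_interior_mem_nhds ho)
    (fun u => (hd u).sub_const o) (fun u hu v hv h => hinj hu hv (sub_left_injective h)) ?_ hpos]
  -- The base point does not matter: it contributes `[γ', y]`, the derivative of a periodic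
  -- function.
  · have hsub : ∀ y : Plane, ∫ u in (0 : ℝ)..(2 * π), bracket (γ u - y) (γ' u) =
        ∫ u in (0 : ℝ)..(2 * π), bracket (γ u) (γ' u) := by
      intro y
      have h1 : ∫ u in (0 : ℝ)..(2 * π), bracket (γ' u) y = 0 := by
        rw [intervalIntegral.integral_eq_sub_of_hasDerivAt
          (fun u _ => hasDerivAt_bracket_const (hd u) y)
          ((by fun_prop : Continuous _).intervalIntegrable _ _)]
        have := hper 0
        rw [zero_add] at this
        rw [this, sub_self]
      have h2 : ∀ u, bracket (γ u - y) (γ' u) = bracket (γ u) (γ' u) + bracket (γ' u) y := by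
        intro u; simp [bracket]; ring
      simp only [h2]
      rw [intervalIntegral.integral_add ((by fun_prop : Continuous _).intervalIntegrable _ _)
        ((by fun_prop : Continuous _).intervalIntegrable _ _), h1, add_zero]
    rw [hsub, hsub]
  · rw [frontier_preimage_add, ← hfr']
    ext z
    simp only [mem_image, mem_preimage]
    exact ⟨fun ⟨u, hu, h⟩ => ⟨u, hu, by rw [← h]; simp⟩, fun ⟨u, hu, h⟩ => ⟨u, hu, by rw [h]; simp⟩⟩

end Area

/-! ### The tangent angle of a convex curve -/

section Angle

theorem injOn_Ico_add {α : Type*} {f : ℝ → α} {T : ℝ} (hT : 0 < T) (hper : Periodic f T)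
    (hinj : InjOn f (Ico 0 T)) (a : ℝ) : InjOn f (Ico a (a + T)) := by
  intro u hu v hv h
  have hu0 := toIcoMod_mem_Ico hT 0 u
  have hv0 := toIcoMod_mem_Ico hT 0 v
  rw [zero_add] at hu0 hv0
  have e : toIcoMod hT 0 u = toIcoMod hT 0 v := by
    apply hinj hu0 hv0
    rw [toIcoMod, toIcoMod, hper.sub_zsmul_eq, hper.sub_zsmul_eq, h]
  rw [← toIcoMod_eq_self hT |>.2 hu, ← toIcoMod_eq_self hT |>.2 hv]
  obtain ⟨n, hn⟩ := (toIcoMod_eq_toIcoMod hT).1 e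
  rw [toIcoMod_eq_toIcoMod hT]
  exact ⟨n, hn⟩

theorem eTheta_eq_iff {φ θ : ℝ} : eTheta φ = eTheta θ ↔ ∃ n : ℤ, φ = θ + n * (2 * π) := by
  constructor
  · intro h
    have h0 := congrArg (fun v : Plane => v 0) h
    have h1 := congrArg (fun v : Plane => v 1) h
    simp only [eTheta_zero, eTheta_one, neg_inj] at h0 h1
    have := (Real.Angle.cos_sin_inj h1 h0)
    obtain ⟨n, hn⟩ := Real.Angle.angle_eq_iff_two_pi_dvd_sub.1 this
    exact ⟨n, by linarith⟩
  · rintro ⟨n, rfl⟩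
    ext i
    fin_cases i <;> simp [Real.sin_add_int_mul_two_pi, Real.cos_add_int_mul_two_pi]

theorem eq_of_smul_eTheta_eq {r s φ θ : ℝ} (hr : 0 < r) (hs : 0 < s)
    (h : r • eTheta φ = s • eTheta θ) : eTheta φ = eTheta θ := by
  have h0 := congrArg (fun v : Plane => v 0) h
  have h1 := congrArg (fun v : Plane => v 1) h
  simp at h0 h1
  have hrs : r = s := by
    have h2 : r ^ 2 = s ^ 2 := by
      have e1 := Real.sin_sq_add_cos_sq φ
      have e2 := Real.sin_sq_add_cos_sq θ
      calc r ^ 2 = (r * Real.sin φ) ^ 2 + (r * Real.cos φ) ^ 2 := by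
            linear_combination (-r ^ 2) * e1
        _ = _ := by rw [h0, h1]; linear_combination (s ^ 2) * e2
    exact (pow_left_inj₀ hr.le hs.le two_ne_zero).1 h2
  subst hrs
  exact smul_right_injective _ hr.ne' h

/-- The function `θ`, with derivative `θ'`, is a continuous angle of the tangent of the curve `γ`,
and `ρ` is the speed of `γ`. -/
structure IsAngle (γ : ℝ → Plane) (ρ θ θ' : ℝ → ℝ) : Prop where
  hasDerivAt : ∀ u, HasDerivAt γ (ρ u • eTheta (θ u)) u
  pos : ∀ u, 0 < ρ u
  continuous_speed : Continuous ρ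
  hasDerivAt_angle : ∀ u, HasDerivAt θ (θ' u) u
  continuous_deriv_angle : Continuous θ'

theorem IsAngle.continuous {γ : ℝ → Plane} {ρ θ θ' : ℝ → ℝ} (h : IsAngle γ ρ θ θ') :
    Continuous γ := continuous_iff_continuousAt.2 fun u => (h.hasDerivAt u).continuousAt

theorem IsAngle.continuous_angle {γ : ℝ → Plane} {ρ θ θ' : ℝ → ℝ} (h : IsAngle γ ρ θ θ') :
    Continuous θ := continuous_iff_continuousAt.2 fun u => (h.hasDerivAt_angle u).continuousAt

/-- With the velocity seen as a complex function `f`, the primitive `G` of `f'/f` is a global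
logarithm of `f / f 0`. The shift by `π / 2` is there because `e_θ` is `i exp(iθ)`. -/
theorem exists_isAngle {γ : ℝ → Plane} (hγ : ContDiff ℝ ∞ γ) (hreg : ∀ u, deriv γ u ≠ 0) :
    ∃ ρ θ θ' : ℝ → ℝ, IsAngle γ ρ θ θ' := by
  set f : ℝ → ℂ := fun u => ⟨deriv γ u 0, deriv γ u 1⟩ with hf
  have hγ' : ContDiff ℝ 1 (deriv γ) := by
    have : ContDiff ℝ 2 γ := contDiff_infty.1 hγ 2
    exact ((contDiff_succ_iff_deriv (n := 1)).1 this).2.2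
  have hfs : ContDiff ℝ 1 f := by
    have h1 : f = fun u => ((deriv γ u 0 : ℝ) : ℂ) + ((deriv γ u 1 : ℝ) : ℂ) * Complex.I := by
      funext u; exact Complex.mk_eq_add_mul_I _ _
    rw [h1]
    have h2 := contDiff_euclidean.1 hγ'
    exact (Complex.ofRealCLM.contDiff.comp (h2 0)).add
      ((Complex.ofRealCLM.contDiff.comp (h2 1)).mul contDiff_const)
  have hf0 : ∀ u, f u ≠ 0 := by
    intro u h
    apply hreg u
    have h0 := congrArg Complex.re h
    have h1 := congrArg Complex.im h
    ext i
    fin_cases i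
    · exact h0
    · exact h1
  have hfd : ∀ u, HasDerivAt f (deriv f u) u := fun u =>
    (hfs.differentiable one_ne_zero u).hasDerivAt
  have hfc : Continuous f := hfs.continuous
  have hf'c : Continuous (deriv f) := hfs.continuous_deriv le_rfl
  set q : ℝ → ℂ := fun u => deriv f u / f u with hq
  have hqc : Continuous q := hf'c.div hfc hf0
  set G : ℝ → ℂ := fun u => ∫ s in (0 : ℝ)..u, q s with hG
  have hGd : ∀ u, HasDerivAt G (q u) u := fun u =>
    intervalIntegral.integral_hasDerivAt_right (hqc.intervalIntegrable _ _)
      (hqc.stronglyMeasurableAtFilter _ _) hqc.continuousAt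
  have hconst : ∀ u, f u * Complex.exp (-G u) = f 0 := by
    have hd : ∀ u, HasDerivAt (fun s => f s * Complex.exp (-G s)) 0 u := by
      intro u
      refine ((hfd u).mul ((hGd u).fun_neg.cexp)).congr_deriv ?_
      have := hf0 u
      simp only [hq]
      field_simp
      ring
    intro u
    have := is_const_of_deriv_eq_zero (fun s => (hd s).differentiableAt) (fun s => (hd s).deriv) u 0
    simpa [hG] using this
  have hexp : ∀ u, f u = f 0 * Complex.exp (G u) := by
    intro u
    rw [← hconst u, mul_assoc, ← Complex.exp_add, neg_add_cancel, Complex.exp_zero, mul_one]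
  have hGre : Continuous fun u => (G u).re :=
    Complex.continuous_re.comp (continuous_iff_continuousAt.2 fun u => (hGd u).continuousAt)
  refine ⟨fun u => ‖f 0‖ * Real.exp (G u).re, fun u => (f 0).arg + (G u).im - π / 2,
    fun u => (q u).im, fun u => ?_, fun u => ?_, ?_, fun u => ?_, ?_⟩
  · have hd : HasDerivAt γ (deriv γ u) u :=
      ((hγ.differentiable (by simp)) u).hasDerivAt
    refine hd.congr_deriv ?_
    have hpol : f u = (‖f 0‖ * Real.exp (G u).re : ℝ) *
        Complex.exp (((f 0).arg + (G u).im : ℝ) * Complex.I) := by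
      rw [hexp u]
      conv_lhs => rw [← Complex.norm_mul_exp_arg_mul_I (f 0), ← Complex.re_add_im (G u),
        Complex.exp_add]
      push_cast
      rw [add_mul, Complex.exp_add]
      ring
    have hre := congrArg Complex.re hpol
    have him := congrArg Complex.im hpol
    rw [Complex.re_ofReal_mul, Complex.exp_ofReal_mul_I_re] at hre
    rw [Complex.im_ofReal_mul, Complex.exp_ofReal_mul_I_im] at him
    ext i
    fin_cases i
    · simp only [Fin.zero_eta, PiLp.smul_apply, eTheta_zero, smul_eq_mul,
        Real.sin_sub_pi_div_two, neg_neg]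
      exact hre
    · simp only [Fin.mk_one, PiLp.smul_apply, eTheta_one, smul_eq_mul, Real.cos_sub_pi_div_two]
      exact him
  · exact mul_pos (norm_pos_iff.2 (hf0 0)) (Real.exp_pos _)
  · fun_prop
  · have : HasDerivAt (fun s => (G s).im) (q u).im u :=
      Complex.imCLM.hasFDerivAt.comp_hasDerivAt u (hGd u)
    exact (this.const_add _).sub_const _
  · exact Complex.continuous_im.comp hqc

variable {K : Set Plane} {γ : ℝ → Plane} {ρ θ θ' : ℝ → ℝ}

/-- A given outer normal has only one support point in a strictly convex set. -/
theorem IsAngle.eq_of_eTheta_eq (hK : StrictConvex ℝ K) (hγK : ∀ u, γ u ∈ K)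
    (hsup : ∀ u, ∀ z ∈ K, bracket z (eTheta (θ u)) ≤ bracket (γ u) (eTheta (θ u)))
    {u v : ℝ} (h : eTheta (θ u) = eTheta (θ v)) : γ u = γ v := by
  refine eq_of_bracket_maximal hK (eTheta_ne_zero (θ v)) (hγK v) (hγK u) (hsup v) ?_
  refine le_antisymm (hsup v _ (hγK u)) ?_
  rw [← h]
  exact hsup u _ (hγK v)

/-- Over half a period the curve is injective, hence so is `θ`, which is therefore strictly monotone
there; the support property excludes the decreasing case. -/
theorem IsAngle.strictMono (ha : IsAngle γ ρ θ θ') (hK : StrictConvex ℝ K) (hγK : ∀ u, γ u ∈ K)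
    (hsup : ∀ u, ∀ z ∈ K, bracket z (eTheta (θ u)) ≤ bracket (γ u) (eTheta (θ u)))
    (hper : Periodic γ (2 * π)) (hinj : InjOn γ (Ico 0 (2 * π))) : StrictMono θ := by
  have hpi := Real.pi_pos
  have hlocal : ∀ u, StrictMonoOn θ (Icc u (u + π)) := by
    intro u
    have hinjθ : InjOn θ (Icc u (u + π)) := by
      intro s hs t ht hst
      exact injOn_Ico_add (by positivity) hper hinj u ⟨hs.1, by linarith [hs.2]⟩
        ⟨ht.1, by linarith [ht.2]⟩ (IsAngle.eq_of_eTheta_eq hK hγK hsup (by rw [hst]))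
    rcases ContinuousOn.strictMonoOn_of_injOn_Icc' (by linarith)
      ha.continuous_angle.continuousOn hinjθ with h | h
    · exact h
    -- If `θ` decreased, the derivative `ρ v sin (θ u - θ v)` of `[γ v, e_{θ u}]` would be positive
    -- just after `u`, and the curve would cross its support line at `γ u`.
    exfalso
    have hev : ∀ᶠ v in nhds u, θ u - π < θ v :=
      ha.continuous_angle.continuousAt.eventually_const_lt (by linarith)
    obtain ⟨δ, hδ, hball⟩ := Metric.eventually_nhds_iff.1 hev
    set η := min (δ / 2) π with hη
    have hη0 : 0 < η := lt_min (by linarith) hpi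
    have hηδ : η < δ := (min_le_left _ _).trans_lt (by linarith)
    have hηπ : η ≤ π := min_le_right _ _
    have hd : ∀ v, HasDerivAt (fun s => bracket (γ s) (eTheta (θ u)))
        (ρ v * Real.sin (θ u - θ v)) v := by
      intro v
      refine (hasDerivAt_bracket_const (ha.hasDerivAt v) _).congr_deriv ?_
      rw [bracket_smul_left, bracket_eTheta_eTheta]
    have hmono : StrictMonoOn (fun s => bracket (γ s) (eTheta (θ u))) (Icc u (u + η)) := by
      refine strictMonoOn_of_deriv_pos (convex_Icc _ _)
        (fun v _ => (hd v).continuousAt.continuousWithinAt) ?_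
      rw [interior_Icc]
      intro v hv
      rw [(hd v).deriv]
      refine mul_pos (ha.pos v) (Real.sin_pos_of_pos_of_lt_pi ?_ ?_)
      · have := h ⟨le_rfl, by linarith⟩ ⟨hv.1.le, by linarith [hv.2]⟩ hv.1
        linarith
      · have := hball (y := v) (by
          rw [Real.dist_eq, abs_lt]; constructor <;> linarith [hv.1, hv.2])
        linarith
    have h1 := hmono ⟨le_rfl, by linarith⟩ ⟨by linarith, le_rfl⟩ (by linarith : u < u + η)
    exact absurd (hsup u _ (hγK (u + η))) (not_le.2 h1)
  -- Intervals of length `π` centred at each point give `θ' ≥ 0` everywhere, which passes from local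
  -- to global.
  have hmono : Monotone θ := by
    refine monotone_of_deriv_nonneg (fun u => (ha.hasDerivAt_angle u).differentiableAt) fun u => ?_
    have hm := (hlocal (u - π / 2)).monotoneOn
    have hmem : Icc (u - π / 2) (u - π / 2 + π) ∈ nhds u :=
      Icc_mem_nhds (by linarith) (by linarith)
    rw [← derivWithin_of_mem_nhds hmem]
    exact hm.derivWithin_nonneg
  intro u v huv
  have h1 : u < min v (u + π) := lt_min huv (by linarith)
  exact (hlocal u ⟨le_rfl, by linarith⟩ ⟨h1.le, min_le_right _ _⟩ h1).trans_le
    (hmono (min_le_left _ _))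

/-- The angle grows by `2πn` over a period, with `n > 0` by monotonicity. If `n ≥ 2`, a normal would
recur strictly inside the period, and with it the point of the curve, against simplicity. -/
theorem IsAngle.add_two_pi (ha : IsAngle γ ρ θ θ') (hK : StrictConvex ℝ K) (hγK : ∀ u, γ u ∈ K)
    (hsup : ∀ u, ∀ z ∈ K, bracket z (eTheta (θ u)) ≤ bracket (γ u) (eTheta (θ u)))
    (hper : Periodic γ (2 * π)) (hinj : InjOn γ (Ico 0 (2 * π))) (u : ℝ) :
    θ (u + 2 * π) = θ u + 2 * π := by
  have hpi := Real.pi_pos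
  have hmono := ha.strictMono hK hγK hsup hper hinj
  have hlt : θ u < θ (u + 2 * π) := hmono (by linarith)
  have hper' : HasDerivAt γ (ρ (u + 2 * π) • eTheta (θ (u + 2 * π))) u := by
    have := (ha.hasDerivAt (u + 2 * π)).comp_add_const u (2 * π)
    rwa [show (fun s => γ (s + 2 * π)) = γ from funext hper] at this
  obtain ⟨n, hn⟩ := eTheta_eq_iff.1
    (eq_of_smul_eTheta_eq (ha.pos _) (ha.pos _) (hper'.unique (ha.hasDerivAt u)))
  have hn0 : 0 < n := by
    by_contra hcon
    have : (n : ℝ) ≤ 0 := by exact_mod_cast not_lt.1 hcon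
    nlinarith
  have hn1 : n ≤ 1 := by
    by_contra hcon
    have h2 : (2 : ℝ) ≤ n := by exact_mod_cast (by omega : (2 : ℤ) ≤ n)
    have hmem : θ u + 2 * π ∈ Ioo (θ u) (θ (u + 2 * π)) := ⟨by linarith, by nlinarith⟩
    obtain ⟨v, hv, hvθ⟩ := intermediate_value_Ioo (by linarith : u ≤ u + 2 * π)
      ha.continuous_angle.continuousOn hmem
    have he : eTheta (θ v) = eTheta (θ u) := eTheta_eq_iff.2 ⟨1, by rw [hvθ]; simp⟩
    have := injOn_Ico_add (by positivity) hper hinj u ⟨hv.1.le, hv.2⟩ ⟨le_rfl, by linarith⟩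
      (IsAngle.eq_of_eTheta_eq hK hγK hsup he)
    exact hv.1.ne this.symm
  obtain rfl : n = 1 := by omega
  simpa using hn

end Angle

/-! ### Wirtinger's inequality -/

section Wirtinger

variable {h k θ θ' : ℝ → ℝ} {a b : ℝ}

/-- This completes the square: with `x = k` and `y = θ'`, adding the derivative of `h² tan (θ - m)`
to `(k² - h²) θ'` gives `(k + h tan (θ - m))² θ'`. -/
theorem hasDerivAt_sq_mul_tan {u x y m : ℝ} {h θ : ℝ → ℝ} (hh : HasDerivAt h (x * y) u)
    (hθ : HasDerivAt θ y u) (hcos : Real.cos (θ u - m) ≠ 0) :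
    HasDerivAt (fun s => h s ^ 2 * Real.tan (θ s - m))
      ((x + h u * Real.tan (θ u - m)) ^ 2 * y - (x ^ 2 - h u ^ 2) * y) u := by
  have h1 := (hh.fun_pow 2).mul
    (((Real.hasDerivAt_tan hcos).comp u (hθ.sub_const m)))
  refine h1.congr_deriv ?_
  simp only [Nat.cast_ofNat, Nat.add_one_sub_one, pow_one, comp_apply]
  have h2 : 1 / Real.cos (θ u - m) ^ 2 = 1 + Real.tan (θ u - m) ^ 2 := by
    rw [Real.tan_eq_sin_div_cos]
    field_simp
    linarith [Real.sin_sq_add_cos_sq (θ u - m)]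
  rw [h2]
  ring

/-- A function that vanishes to first order at the end of an interval of length at most `π`
absorbs the singularity of the tangent there. -/
theorem abs_sq_mul_tan_le {x y t M : ℝ} (hM : |x| ≤ M * y) (hy : 0 < y) (hy' : y ≤ π / 2)
    (hc : Real.sin y ≤ Real.cos t) : |x ^ 2 * Real.tan t| ≤ M ^ 2 * (π / 2) * y := by
  have hs : 2 / π * y ≤ Real.sin y := Real.mul_le_sin hy.le hy'
  have hpi := Real.pi_pos
  have hs0 : 0 < 2 / π * y := by positivity
  have hct : 0 < Real.cos t := by linarith
  have hx2 : x ^ 2 ≤ (M * y) ^ 2 := by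
    rw [← sq_abs x]
    exact pow_le_pow_left₀ (abs_nonneg x) hM 2
  rw [Real.tan_eq_sin_div_cos, abs_mul, abs_div, abs_of_pos hct, abs_of_nonneg (sq_nonneg x)]
  calc x ^ 2 * (|Real.sin t| / Real.cos t) ≤ (M * y) ^ 2 * (1 / (2 / π * y)) := by
        gcongr
        · exact Real.abs_sin_le_one t
        · linarith
    _ = _ := by field_simp

/-- **Wirtinger's inequality** on an interval of angular length at most `π`, with the case of
equality for functions that vanish at the ends together with their derivatives. -/
theorem wirtinger (hab : a < b) (hh : ∀ u, HasDerivAt h (k u * θ' u) u)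
    (hθ : ∀ u, HasDerivAt θ (θ' u) u) (hθ' : Continuous θ') (hmono : StrictMono θ)
    (hk : Continuous k) (hlen : θ b ≤ θ a + π) (hha : h a = 0) (hhb : h b = 0) (hka : k a = 0) :
    0 ≤ ∫ u in a..b, (k u ^ 2 - h u ^ 2) * θ' u ∧
      (∫ u in a..b, (k u ^ 2 - h u ^ 2) * θ' u = 0 → ∀ u ∈ Icc a b, h u = 0) := by
  have hhc : Continuous h := continuous_iff_continuousAt.2 fun u => (hh u).continuousAt
  have hθc : Continuous θ := continuous_iff_continuousAt.2 fun u => (hθ u).continuousAt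
  have hθ'0 : ∀ u, 0 ≤ θ' u := fun u => by
    rw [← (hθ u).deriv]; exact hmono.monotone.deriv_nonneg
  -- Centring at the middle angle keeps `|θ - m| < π / 2` inside the interval.
  set m := (θ a + θ b) / 2 with hm
  have hcos : ∀ u ∈ Ioo a b, 0 < Real.cos (θ u - m) := by
    intro u hu
    have h1 := hmono hu.1
    have h2 := hmono hu.2
    exact Real.cos_pos_of_mem_Ioo ⟨by linarith, by linarith⟩
  set f : ℝ → ℝ := fun u => (k u ^ 2 - h u ^ 2) * θ' u with hf
  have hfc : Continuous f := by fun_prop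
  -- `Φ` is nondecreasing; it tends to `0` at `a` and to the whole integral at `b`, because the
  -- tangent term dies out at both ends.
  set Φ : ℝ → ℝ := fun u => (∫ s in a..u, f s) + h u ^ 2 * Real.tan (θ u - m) with hΦ
  have hΦd : ∀ u ∈ Ioo a b, HasDerivAt Φ ((k u + h u * Real.tan (θ u - m)) ^ 2 * θ' u) u := by
    intro u hu
    have h1 : HasDerivAt (fun v => ∫ s in a..v, f s) (f u) u :=
      intervalIntegral.integral_hasDerivAt_right (hfc.intervalIntegrable _ _)
      (hfc.stronglyMeasurableAtFilter _ _) hfc.continuousAt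
    have h2 := hasDerivAt_sq_mul_tan (m := m) (hh u) (hθ u) (hcos u hu).ne'
    refine (h1.add h2).congr_deriv ?_
    simp only [hf]; ring
  have hΦmono : MonotoneOn Φ (Ioo a b) := by
    refine monotoneOn_of_deriv_nonneg (convex_Ioo a b)
      (fun u hu => (hΦd u hu).continuousAt.continuousWithinAt) ?_ ?_
    · rw [interior_Ioo]
      exact fun u hu => (hΦd u hu).differentiableAt.differentiableWithinAt
    · rw [interior_Ioo]
      intro u hu
      rw [(hΦd u hu).deriv]
      exact mul_nonneg (sq_nonneg _) (hθ'0 u)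
  obtain ⟨M, hM⟩ := (isCompact_Icc (a := a) (b := b)).exists_bound_of_continuousOn hk.continuousOn
  -- `M` is left free: a global bound on `k` serves for the limits of the tangent term, a small one
  -- near `a` for `C = 0`.
  have hlip : ∀ M u v, u ≤ v → (∀ s ∈ Icc u v, ‖k s‖ ≤ M) →
      |h v - h u| ≤ M * (θ v - θ u) := by
    intro M u v huv hM
    have h1 : ∫ s in u..v, k s * θ' s = h v - h u :=
      intervalIntegral.integral_eq_sub_of_hasDerivAt (fun s _ => hh s)
        ((by fun_prop : Continuous fun s => k s * θ' s).intervalIntegrable _ _)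
    have h2 : ∫ s in u..v, M * θ' s = M * (θ v - θ u) := by
      rw [intervalIntegral.integral_const_mul, intervalIntegral.integral_eq_sub_of_hasDerivAt
        (fun s _ => hθ s) (hθ'.intervalIntegrable _ _)]
    rw [← h1, ← h2, ← Real.norm_eq_abs]
    refine intervalIntegral.norm_integral_le_of_norm_le huv ?_
      ((by fun_prop : Continuous fun s => M * θ' s).intervalIntegrable (μ := volume) _ _)
    refine Filter.Eventually.of_forall fun s hs => ?_
    rw [norm_mul, Real.norm_of_nonneg (hθ'0 s)]
    exact mul_le_mul_of_nonneg_right (hM s ⟨hs.1.le, hs.2⟩) (hθ'0 s)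
  -- Since `m - θ a ≤ π / 2`, the distance from `θ u` to `m` is at most `π / 2 - (θ u - θ a)`.
  have heva : ∀ᶠ u in nhdsWithin a (Ioi a), u < b ∧ θ u - θ a ≤ π / 2 ∧
      Real.sin (θ u - θ a) ≤ Real.cos (θ u - m) := by
    have e1 : ∀ᶠ u in nhds a, θ u < θ a + π / 2 :=
      hθc.continuousAt.eventually_lt_const (by linarith [Real.pi_pos])
    have e2 : ∀ᶠ u in nhds a, θ u < m :=
      hθc.continuousAt.eventually_lt_const (by linarith [hmono hab])
    filter_upwards [nhdsWithin_le_nhds (eventually_lt_nhds hab), nhdsWithin_le_nhds e1,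
      nhdsWithin_le_nhds e2, self_mem_nhdsWithin] with u hub hu1 hu2 hau
    have h1 := hmono (mem_Ioi.1 hau)
    refine ⟨hub, by linarith, ?_⟩
    rw [← Real.cos_pi_div_two_sub, ← Real.cos_abs (θ u - m)]
    refine Real.cos_le_cos_of_nonneg_of_le_pi (abs_nonneg _) (by linarith) ?_
    rw [abs_le]
    constructor <;> linarith
  have hevb : ∀ᶠ u in nhdsWithin b (Iio b), a < u ∧ θ b - θ u ≤ π / 2 ∧
      Real.sin (θ b - θ u) ≤ Real.cos (θ u - m) := by
    have e1 : ∀ᶠ u in nhds b, θ b - π / 2 < θ u :=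
      hθc.continuousAt.eventually_const_lt (by linarith [Real.pi_pos])
    have e2 : ∀ᶠ u in nhds b, m < θ u :=
      hθc.continuousAt.eventually_const_lt (by linarith [hmono hab])
    filter_upwards [nhdsWithin_le_nhds (eventually_gt_nhds hab), nhdsWithin_le_nhds e1,
      nhdsWithin_le_nhds e2, self_mem_nhdsWithin] with u hub hu1 hu2 hau
    have h1 := hmono (mem_Iio.1 hau)
    refine ⟨hub, by linarith, ?_⟩
    rw [← Real.cos_pi_div_two_sub, ← Real.cos_abs (θ u - m)]
    refine Real.cos_le_cos_of_nonneg_of_le_pi (abs_nonneg _) (by linarith) ?_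
    rw [abs_le]
    constructor <;> linarith
  have hlima : Filter.Tendsto (fun u => h u ^ 2 * Real.tan (θ u - m)) (nhdsWithin a (Ioi a))
      (nhds 0) := by
    refine squeeze_zero_norm' (a := fun u => M ^ 2 * (π / 2) * (θ u - θ a)) ?_ ?_
    · filter_upwards [heva, self_mem_nhdsWithin] with u hu hau
      have h3 := hlip M a u (mem_Ioi.1 hau).le fun s hs => hM s ⟨hs.1, hs.2.trans hu.1.le⟩
      rw [hha, sub_zero] at h3
      exact abs_sq_mul_tan_le h3 (by linarith [hmono (mem_Ioi.1 hau)]) hu.2.1 hu.2.2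
    · have : Filter.Tendsto (fun u => M ^ 2 * (π / 2) * (θ u - θ a)) (nhds a)
          (nhds (M ^ 2 * (π / 2) * (θ a - θ a))) := by
        have hcc : Continuous fun u => M ^ 2 * (π / 2) * (θ u - θ a) := by fun_prop
        exact hcc.tendsto a
      rw [sub_self, mul_zero] at this
      exact this.mono_left nhdsWithin_le_nhds
  have hlimb : Filter.Tendsto (fun u => h u ^ 2 * Real.tan (θ u - m)) (nhdsWithin b (Iio b))
      (nhds 0) := by
    refine squeeze_zero_norm' (a := fun u => M ^ 2 * (π / 2) * (θ b - θ u)) ?_ ?_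
    · filter_upwards [hevb, self_mem_nhdsWithin] with u hu hub
      have h3 := hlip M u b (mem_Iio.1 hub).le fun s hs => hM s ⟨hu.1.le.trans hs.1, hs.2⟩
      rw [hhb, zero_sub, abs_neg] at h3
      exact abs_sq_mul_tan_le h3 (by linarith [hmono (mem_Iio.1 hub)]) hu.2.1 hu.2.2
    · have : Filter.Tendsto (fun u => M ^ 2 * (π / 2) * (θ b - θ u)) (nhds b)
          (nhds (M ^ 2 * (π / 2) * (θ b - θ b))) := by
        have hcc : Continuous fun u => M ^ 2 * (π / 2) * (θ b - θ u) := by fun_prop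
        exact hcc.tendsto b
      rw [sub_self, mul_zero] at this
      exact this.mono_left nhdsWithin_le_nhds
  have hIc : Continuous fun u => ∫ s in a..u, f s :=
    intervalIntegral.continuous_primitive (fun _ _ => hfc.intervalIntegrable _ _) a
  have hΦa : Filter.Tendsto Φ (nhdsWithin a (Ioi a)) (nhds 0) := by
    have := ((hIc.tendsto a).mono_left (nhdsWithin_le_nhds (s := Ioi a))).add hlima
    rwa [intervalIntegral.integral_same, add_zero] at this
  have hΦb : Filter.Tendsto Φ (nhdsWithin b (Iio b)) (nhds (∫ s in a..b, f s)) := by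
    have := ((hIc.tendsto b).mono_left (nhdsWithin_le_nhds (s := Iio b))).add hlimb
    rwa [add_zero] at this
  have hΦ0 : ∀ u ∈ Ioo a b, 0 ≤ Φ u := by
    intro u hu
    refine le_of_tendsto hΦa ?_
    filter_upwards [Ioo_mem_nhdsGT hu.1] with v hv
    exact hΦmono ⟨hv.1, hv.2.trans hu.2⟩ hu hv.2.le
  have hΦE : ∀ u ∈ Ioo a b, Φ u ≤ ∫ s in a..b, f s := by
    intro u hu
    refine ge_of_tendsto hΦb ?_
    filter_upwards [Ioo_mem_nhdsLT hu.2] with v hv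
    exact hΦmono hu ⟨hu.1.trans hv.1, hv.2⟩ hv.1.le
  obtain ⟨c, hc⟩ := exists_between hab
  refine ⟨(hΦ0 c hc).trans (hΦE c hc), fun hE => ?_⟩
  -- If the integral is zero, `Φ` is squeezed to the constant `0`.
  have hz : ∀ u ∈ Ioo a b, (k u + h u * Real.tan (θ u - m)) ^ 2 * θ' u = 0 := by
    intro u hu
    have hev : Φ =ᶠ[nhds u] fun _ => 0 := by
      filter_upwards [Ioo_mem_nhds hu.1 hu.2] with v hv
      exact le_antisymm ((hΦE v hv).trans hE.le) (hΦ0 v hv)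
    exact (hΦd u hu).unique ((hasDerivAt_const u 0).congr_of_eventuallyEq hev)
  have hz' : ∀ u ∈ Ioo a b, (k u + h u * Real.tan (θ u - m)) * θ' u = 0 := by
    intro u hu
    rcases mul_eq_zero.1 (hz u hu) with h1 | h1
    · rw [pow_eq_zero_iff two_ne_zero] at h1; rw [h1, zero_mul]
    · rw [h1, mul_zero]
  set C := h c / Real.cos (θ c - m) with hC
  -- The quotient `h / cos (θ - m)` has derivative `(k + h tan (θ - m)) θ' / cos (θ - m) = 0`, even
  -- where `θ'` vanishes.
  have hhC : ∀ u ∈ Ioo a b, h u = C * Real.cos (θ u - m) := by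
    have hq : ∀ u ∈ Ioo a b, HasDerivAt (fun s => h s / Real.cos (θ s - m)) 0 u := by
      intro u hu
      have h1 := (hh u).fun_div ((Real.hasDerivAt_cos _).comp u ((hθ u).sub_const m))
        (hcos u hu).ne'
      refine h1.congr_deriv ?_
      have h2 := hz' u hu
      have h3 := (hcos u hu).ne'
      simp only [comp_apply]
      rw [div_eq_zero_iff]
      left
      rw [Real.tan_eq_sin_div_cos] at h2
      field_simp at h2
      linear_combination h2
    intro u hu
    have h1 : h u / Real.cos (θ u - m) = C :=
      (convex_Ioo a b).is_const_of_fderivWithin_eq_zero (𝕜 := ℝ)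
        (f := fun s => h s / Real.cos (θ s - m))
        (fun v hv => (hq v hv).differentiableAt.differentiableWithinAt)
        (fun v hv => by
          rw [fderivWithin_of_isOpen isOpen_Ioo hv]
          ext
          simp [(hq v hv).deriv]) hu hc
    rw [← h1, div_mul_cancel₀ _ (hcos u hu).ne']
  -- As `k a = 0`, `h` is `o(θ - θ a)` at `a`, whereas `cos (θ - m) ≥ (2 / π) (θ - θ a)` there.
  have hC0 : C = 0 := by
    have hsmall : ∀ ε > 0, |C| * (2 / π) ≤ ε := by
      intro ε hε
      have hkε : ∀ᶠ v in nhds a, ‖k v‖ < ε :=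
        hk.norm.continuousAt.eventually_lt_const (by simpa [hka] using hε)
      obtain ⟨δ, hδ, hball⟩ := Metric.eventually_nhds_iff.1 hkε
      have hδ' : ∀ᶠ u in nhdsWithin a (Ioi a), u < a + δ :=
        nhdsWithin_le_nhds (eventually_lt_nhds (by linarith))
      obtain ⟨u, hu, huδ, hau⟩ := (heva.and (hδ'.and self_mem_nhdsWithin)).exists
      have h1 := hlip ε a u (mem_Ioi.1 hau).le fun s hs => (hball (by
        rw [Real.dist_eq, abs_lt]
        constructor <;> linarith [hs.1, hs.2])).le
      have hy : 0 < θ u - θ a := by linarith [hmono (mem_Ioi.1 hau)]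
      have h2 := (Real.mul_le_sin hy.le hu.2.1).trans hu.2.2
      rw [hha, sub_zero, hhC u ⟨mem_Ioi.1 hau, hu.1⟩, abs_mul,
        abs_of_pos (hcos u ⟨mem_Ioi.1 hau, hu.1⟩)] at h1
      have h3 := mul_le_mul_of_nonneg_left h2 (abs_nonneg C)
      refine le_of_mul_le_mul_right ?_ hy
      linarith
    have h0 := le_of_forall_pos_le_add (a := |C| * (2 / π)) (b := 0)
      fun ε hε => by simpa using hsmall ε hε
    have hpi : 0 < 2 / π := by positivity
    exact abs_eq_zero.1 (le_antisymm (nonpos_of_mul_nonpos_left h0 hpi) (abs_nonneg C))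
  intro u hu
  rcases eq_or_lt_of_le hu.1 with rfl | h1
  · exact hha
  rcases eq_or_lt_of_le hu.2 with rfl | h2
  · exact hhb
  rw [hhC u ⟨h1, h2⟩, hC0, zero_mul]

end Wirtinger

/-! ### Boundary curves parametrized with their normal angle -/

section BoundaryAngle

/-- The curve `γ` runs once, in the positive direction, around the boundary of the strictly convex
body `K`; `θ` is the angle of its outer normal and `ρ` its speed. -/
structure IsBoundaryAngle (K : Set Plane) (γ : ℝ → Plane) (ρ θ θ' : ℝ → ℝ) : Prop
    extends IsAngle γ ρ θ θ' where
  isCompact : IsCompact K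
  strictConvex : StrictConvex ℝ K
  interior_nonempty : (interior K).Nonempty
  range_eq : range γ = frontier K
  periodic : Periodic γ (2 * π)
  injOn : InjOn γ (Ico 0 (2 * π))
  strictMono : StrictMono θ
  angle_add : ∀ u, θ (u + 2 * π) = θ u + 2 * π
  support : ∀ u, ∀ z ∈ K, bracket z (eTheta (θ u)) ≤ bracket (γ u) (eTheta (θ u))

namespace IsBoundaryAngle

variable {K : Set Plane} {γ : ℝ → Plane} {ρ θ θ' : ℝ → ℝ}

theorem mem (h : IsBoundaryAngle K γ ρ θ θ') (u : ℝ) : γ u ∈ K :=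
  h.isCompact.isClosed.frontier_subset (h.range_eq ▸ mem_range_self u)

theorem eTheta_periodic (h : IsBoundaryAngle K γ ρ θ θ') :
    Periodic (fun u => eTheta (θ u)) (2 * π) := fun u =>
  eTheta_eq_iff.2 ⟨1, by rw [h.angle_add]; simp⟩

theorem deriv_periodic (h : IsBoundaryAngle K γ ρ θ θ') :
    Periodic (fun u => ρ u • eTheta (θ u)) (2 * π) := by
  intro u
  have h1 := (h.hasDerivAt (u + 2 * π)).comp_add_const u (2 * π)
  rw [show (fun s => γ (s + 2 * π)) = γ from funext h.periodic] at h1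
  exact h1.unique (h.hasDerivAt u)

theorem bracket_sub_pos (h : IsBoundaryAngle K γ ρ θ θ') {o : Plane} (ho : o ∈ interior K) (u : ℝ) :
    0 < bracket (γ u - o) (eTheta (θ u)) := by
  obtain ⟨z, hz, hlt⟩ := exists_bracket_lt_of_mem_interior ho (eTheta_ne_zero (θ u))
  have := h.support u z hz
  rw [bracket_sub_left]
  linarith

theorem eq_of_bracket_eq (h : IsBoundaryAngle K γ ρ θ θ') {u : ℝ} {z : Plane} (hz : z ∈ K)
    (he : bracket z (eTheta (θ u)) = bracket (γ u) (eTheta (θ u))) : z = γ u :=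
  eq_of_bracket_maximal h.strictConvex (eTheta_ne_zero (θ u)) (h.mem u) hz (h.support u) he

theorem mem_of_forall_le (h : IsBoundaryAngle K γ ρ θ θ') {z : Plane}
    (hz : ∀ u, bracket z (eTheta (θ u)) ≤ bracket (γ u) (eTheta (θ u))) : z ∈ K := by
  obtain ⟨o, ho⟩ := h.interior_nonempty
  exact mem_of_forall_bracket_le h.strictConvex.convex h.isCompact h.range_eq ho
    (fun u => h.bracket_sub_pos ho u) hz

theorem area_eq (h : IsBoundaryAngle K γ ρ θ θ') (x : Plane) :
    area K = 1 / 2 * ∫ u in (0 : ℝ)..(2 * π), bracket (γ u - x) (ρ u • eTheta (θ u)) := by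
  obtain ⟨o, ho⟩ := h.interior_nonempty
  have := h.continuous_angle
  have := h.continuous_speed
  refine area_eq_integral_bracket h.strictConvex.convex h.isCompact h.hasDerivAt (by fun_prop)
    h.periodic h.injOn h.range_eq ho (fun u => ?_) x
  rw [bracket_smul_right]
  exact mul_nonneg (h.pos u).le (h.bracket_sub_pos ho u).le

theorem area_pos (h : IsBoundaryAngle K γ ρ θ θ') : 0 < area K :=
  ENNReal.toReal_pos (Measure.measure_pos_of_nonempty_interior _ h.interior_nonempty).ne'
    h.isCompact.measure_lt_top.ne

theorem exists_angle_eq (h : IsBoundaryAngle K γ ρ θ θ') (φ : ℝ) :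
    ∃ u, eTheta (θ u) = eTheta φ := by
  have hper : Periodic eTheta (2 * π) := fun s => eTheta_eq_iff.2 ⟨1, by simp⟩
  obtain ⟨ψ, hψ, he⟩ := hper.exists_mem_Ico (by positivity) φ (θ 0)
  rw [← h.angle_add 0] at hψ
  obtain ⟨u, -, hu⟩ := intermediate_value_Icc (by positivity : (0 : ℝ) ≤ 0 + 2 * π)
    h.continuous_angle.continuousOn ⟨hψ.1, hψ.2.le⟩
  exact ⟨u, by rw [hu, he]⟩

end IsBoundaryAngle

/-- Tangents are support lines and miss the interior, so `[γ - o, γ']` never vanishes; by continuity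
its sign, the orientation, is constant. -/
theorem exists_oriented {γ : ℝ → Plane} (hγ : IsStrictlyConvexCurve γ) :
    IsCompact (region γ) ∧ (interior (region γ)).Nonempty ∧
      ∀ o ∈ interior (region γ), (∀ u, 0 < bracket (γ u - o) (deriv γ u)) ∨
        ∀ u, bracket (γ u - o) (deriv γ u) < 0 := by
  have hd : ∀ u, HasDerivAt γ (deriv γ u) u := fun u =>
    ((hγ.smooth.differentiable (by simp)) u).hasDerivAt
  have hmem : ∀ u, γ u ∈ region γ := fun u => subset_convexHull ℝ _ (mem_range_self u)
  have hcl : IsClosed (region γ) := by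
    rw [← closure_subset_iff_isClosed, closure_eq_self_union_frontier, hγ.boundary]
    exact union_subset Subset.rfl (range_subset_iff.2 hmem)
  have hbd : Bornology.IsBounded (range γ) := by
    rw [← hγ.closed.image_Icc (by positivity : (0 : ℝ) < 2 * π) 0]
    exact (isCompact_Icc.image hγ.smooth.continuous).isBounded
  have hcomp : IsCompact (region γ) :=
    Metric.isCompact_of_isClosed_isBounded hcl (isBounded_convexHull.2 hbd)
  refine ⟨hcomp, interior_nonempty_of_range_subset hγ.strictConvex hmem (hd 0) (hγ.regular 0),
    fun o ho => ?_⟩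
  have hne : ∀ u, bracket (γ u - o) (deriv γ u) ≠ 0 := by
    intro u
    obtain ⟨c, -, -, h⟩ := exists_tangent_support hγ.strictConvex.convex hcl
      (fun u => hγ.boundary ▸ mem_range_self u) (hd u) (hγ.regular u) ho
    intro h0
    have := h o ho
    rw [h0, mul_zero] at this
    exact lt_irrefl _ this
  have hcont : Continuous fun u => bracket (γ u - o) (deriv γ u) := by
    have h1 := hγ.smooth.continuous
    have h2 := hγ.smooth.continuous_deriv (by simp)
    fun_prop
  by_contra! hcon
  obtain ⟨⟨u, hu⟩, v, hv⟩ := hcon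
  obtain ⟨w, hw⟩ := mem_range_of_exists_le_of_exists_ge hcont ⟨u, hu⟩ ⟨v, hv⟩
  exact hne w hw

theorem IsStrictlyConvexCurve.exists_isBoundaryAngle {γ : ℝ → Plane}
    (hγ : IsStrictlyConvexCurve γ) {o : Plane} (ho : o ∈ interior (region γ))
    (hpos : ∀ u, 0 < bracket (γ u - o) (deriv γ u)) :
    ∃ ρ θ θ', IsBoundaryAngle (region γ) γ ρ θ θ' := by
  obtain ⟨ρ, θ, θ', ha⟩ := exists_isAngle hγ.smooth hγ.regular
  obtain ⟨hcomp, hint, -⟩ := exists_oriented hγ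
  have hmem : ∀ u, γ u ∈ region γ := fun u => subset_convexHull ℝ _ (mem_range_self u)
  have hsup : ∀ u, ∀ z ∈ region γ,
      bracket z (eTheta (θ u)) ≤ bracket (γ u) (eTheta (θ u)) := by
    intro u z hz
    have hd := ha.hasDerivAt u
    have hne : ρ u • eTheta (θ u) ≠ 0 := smul_ne_zero (ha.pos u).ne' (eTheta_ne_zero _)
    obtain ⟨c, -, hc1, hc2⟩ := exists_tangent_support hγ.strictConvex.convex hcomp.isClosed
      (fun u => hγ.boundary ▸ mem_range_self u) hd hne ho
    have h0 := hpos u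
    rw [hd.deriv] at h0
    have hc : 0 < c := pos_of_mul_pos_left (hc2 o ho) h0.le
    have h1 := nonneg_of_mul_nonneg_right (hc1 z hz) hc
    rw [bracket_smul_right] at h1
    have h2 := nonneg_of_mul_nonneg_right h1 (ha.pos u)
    rw [bracket_sub_left] at h2
    linarith
  exact ⟨ρ, θ, θ', { ha with
    isCompact := hcomp
    strictConvex := hγ.strictConvex
    interior_nonempty := hint
    range_eq := hγ.boundary.symm
    periodic := hγ.closed
    injOn := hγ.simple
    strictMono := ha.strictMono hγ.strictConvex hmem hsup hγ.closed hγ.simple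
    angle_add := ha.add_two_pi hγ.strictConvex hmem hsup hγ.closed hγ.simple
    support := hsup }⟩

theorem deriv_comp_neg_plane (γ : ℝ → Plane) (u : ℝ) :
    deriv (fun s => γ (-s)) u = -deriv γ (-u) := deriv_comp_neg γ u

theorem range_comp_neg (γ : ℝ → Plane) : range (fun s => γ (-s)) = range γ :=
  (Equiv.neg ℝ).surjective.range_comp γ

theorem IsStrictlyConvexCurve.comp_neg {γ : ℝ → Plane} (hγ : IsStrictlyConvexCurve γ) :
    IsStrictlyConvexCurve fun u => γ (-u) := by
  have hr : region (fun u => γ (-u)) = region γ := by unfold region; rw [range_comp_neg]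
  refine ⟨hγ.smooth.comp contDiff_neg, fun u => ?_, fun u => ?_, fun u hu v hv h => ?_, ?_, ?_⟩
  · have := hγ.closed (-(u + 2 * π))
    rw [← this]
    ring_nf
  · rw [deriv_comp_neg_plane]
    exact neg_ne_zero.2 (hγ.regular _)
  -- Reflection turns `Ico` into an interval open on the left; a period starting at `-max u v`
  -- contains both reflected points.
  · have hmax : max u v < 2 * π := max_lt hu.2 hv.2
    have hu' : -u ∈ Ico (-max u v) (-max u v + 2 * π) :=
      ⟨neg_le_neg (le_max_left _ _), by linarith [hu.1]⟩
    have hv' : -v ∈ Ico (-max u v) (-max u v + 2 * π) :=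
      ⟨neg_le_neg (le_max_right _ _), by linarith [hv.1]⟩
    exact neg_injective (injOn_Ico_add (by positivity) hγ.closed hγ.simple _ hu' hv' h)
  · rw [hr]; exact hγ.strictConvex
  · rw [hr, range_comp_neg]; exact hγ.boundary

theorem length_comp_neg {γ : ℝ → Plane} (hγ : IsStrictlyConvexCurve γ) {Q : Set Plane}
    (hQ : ∀ y ∈ Q, -y ∈ Q) : length Q (fun u => γ (-u)) = length Q γ := by
  have hper : Periodic (fun u => gauge Q (deriv γ u)) (2 * π) := by
    intro u
    have : deriv γ (u + 2 * π) = deriv γ u := by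
      rw [← deriv_comp_add_const, show (fun s => γ (s + 2 * π)) = γ from funext hγ.closed]
    simp only [this]
  unfold length
  simp only [deriv_comp_neg_plane, gauge_neg hQ]
  rw [intervalIntegral.integral_comp_neg (fun u => gauge Q (deriv γ u))]
  have := hper.intervalIntegral_add_eq (-(2 * π)) 0
  rw [neg_add_cancel, zero_add] at this
  rw [neg_zero, this]

/-- A clockwise curve is run backwards; this keeps its trace, and its length for a symmetric `Q`. -/
theorem exists_isBoundaryAngle_of_curve {γ : ℝ → Plane} (hγ : IsStrictlyConvexCurve γ) :
    ∃ (η : ℝ → Plane) (ρ θ θ' : ℝ → ℝ), IsBoundaryAngle (region γ) η ρ θ θ' ∧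
      range η = range γ ∧ ∀ Q : Set Plane, (∀ y ∈ Q, -y ∈ Q) → length Q η = length Q γ := by
  obtain ⟨-, ⟨o, ho⟩, hor⟩ := exists_oriented hγ
  rcases hor o ho with h | h
  · obtain ⟨ρ, θ, θ', hb⟩ := hγ.exists_isBoundaryAngle ho h
    exact ⟨γ, ρ, θ, θ', hb, rfl, fun _ _ => rfl⟩
  · have hr : region (fun u => γ (-u)) = region γ := by unfold region; rw [range_comp_neg]
    obtain ⟨ρ, θ, θ', hb⟩ := hγ.comp_neg.exists_isBoundaryAngle (o := o) (by rwa [hr]) (fun u => by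
      rw [deriv_comp_neg_plane, bracket_neg_right]
      linarith [h (-u)])
    rw [hr] at hb
    exact ⟨_, ρ, θ, θ', hb, range_comp_neg γ, fun Q hQ => length_comp_neg hγ hQ⟩

end BoundaryAngle

/-! ### The unit ball and the dual norm -/

section UnitBall

variable {P : Set Plane}

/-- Here the parameter is itself the angle, so `θ = id`. The support property and injectivity are
derived from the sign of the derivative `c ψ sin (φ - ψ)` of `[p ψ, e_φ]`. -/
theorem IsSmoothUnitBall.exists_isBoundaryAngle (hP : IsSmoothUnitBall P) :
    (0 : Plane) ∈ interior P ∧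
      ∃ (p : ℝ → Plane) (c : ℝ → ℝ), IsBoundaryAngle P p c id fun _ => 1 := by
  obtain ⟨p, hp, hper, hrange, hc⟩ := hP.boundary
  choose c hc0 hc using hc
  have hpi := Real.pi_pos
  have hd : ∀ φ, HasDerivAt p (c φ • eTheta φ) φ := fun φ => by
    rw [← hc]; exact ((hp.differentiable (by simp)) φ).hasDerivAt
  have hmem : ∀ φ, p φ ∈ P := fun φ =>
    hP.isCompact.isClosed.frontier_subset (hrange ▸ mem_range_self φ)
  have hint : (interior P).Nonempty := interior_nonempty_of_range_subset hP.strictConvex hmem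
    (hd 0) (smul_ne_zero (hc0 0).ne' (eTheta_ne_zero _))
  have hzero : (0 : Plane) ∈ interior P := by
    obtain ⟨o, ho⟩ := hint
    have ho' : -o ∈ interior P := by
      have hPneg : (fun z : Plane => -z) ⁻¹' P = P := by
        ext z
        exact ⟨fun h => by simpa using hP.symmetric _ h, fun h => hP.symmetric _ h⟩
      have h1 : o ∈ (fun z : Plane => -z) ⁻¹' interior ((fun z : Plane => -z) ⁻¹' P) := by
        have := (Homeomorph.neg Plane).preimage_interior ((fun z : Plane => -z) ⁻¹' P)
        have h2 : (fun z : Plane => -z) ⁻¹' ((fun z : Plane => -z) ⁻¹' P) = P := by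
          rw [hPneg, hPneg]
        simp only [Homeomorph.coe_neg] at this
        change o ∈ Neg.neg ⁻¹' interior ((fun z : Plane => -z) ⁻¹' P)
        rw [this]
        exact h2.symm ▸ ho
      rwa [hPneg] at h1
    have := hP.strictConvex.convex.interior ho ho' (a := 1 / 2) (b := 1 / 2) (by norm_num)
      (by norm_num) (by norm_num)
    simpa using this
  have hgd : ∀ φ ψ, HasDerivAt (fun s => bracket (p s) (eTheta φ)) (c ψ * Real.sin (φ - ψ)) ψ := by
    intro φ ψ
    refine (hasDerivAt_bracket_const (hd ψ) _).congr_deriv ?_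
    rw [bracket_smul_left, bracket_eTheta_eTheta]
  have hloc : ∀ φ, ∀ ψ ∈ Icc (φ - π) (φ + π),
      bracket (p ψ) (eTheta φ) ≤ bracket (p φ) (eTheta φ) := by
    intro φ ψ hψ
    rcases le_total ψ φ with hle | hle
    · have hmono : MonotoneOn (fun s => bracket (p s) (eTheta φ)) (Icc (φ - π) φ) := by
        refine monotoneOn_of_deriv_nonneg (convex_Icc _ _)
          (fun s _ => (hgd φ s).continuousAt.continuousWithinAt)
          (fun s _ => (hgd φ s).differentiableAt.differentiableWithinAt) fun s hs => ?_
        rw [interior_Icc] at hs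
        rw [(hgd φ s).deriv]
        exact mul_nonneg (hc0 s).le
          (Real.sin_nonneg_of_nonneg_of_le_pi (by linarith [hs.2]) (by linarith [hs.1]))
      exact hmono ⟨hψ.1, hle⟩ ⟨by linarith, le_rfl⟩ hle
    · have hanti : AntitoneOn (fun s => bracket (p s) (eTheta φ)) (Icc φ (φ + π)) := by
        refine antitoneOn_of_deriv_nonpos (convex_Icc _ _)
          (fun s _ => (hgd φ s).continuousAt.continuousWithinAt)
          (fun s _ => (hgd φ s).differentiableAt.differentiableWithinAt) fun s hs => ?_
        rw [interior_Icc] at hs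
        rw [(hgd φ s).deriv]
        exact mul_nonpos_of_nonneg_of_nonpos (hc0 s).le
          (Real.sin_nonpos_of_nonpos_of_neg_pi_le (by linarith [hs.1]) (by linarith [hs.2]))
      exact hanti ⟨le_rfl, by linarith⟩ ⟨hle, hψ.2⟩ hle
  have hsup : ∀ φ, ∀ z ∈ P, bracket z (eTheta φ) ≤ bracket (p φ) (eTheta φ) := by
    intro φ z hz
    obtain ⟨y, hy, hmax⟩ := hP.isCompact.exists_isMaxOn ⟨z, hz⟩
      (by fun_prop : Continuous fun y => bracket y (eTheta φ)).continuousOn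
    have hyf : y ∈ frontier P := by
      refine ⟨subset_closure hy, fun hyi => ?_⟩
      obtain ⟨x, hx, hlt⟩ := exists_bracket_lt_of_mem_interior hyi (eTheta_ne_zero φ)
      exact absurd (hmax hx) (not_le.2 hlt)
    rw [← hrange] at hyf
    obtain ⟨s, rfl⟩ := hyf
    obtain ⟨t, ht, hst⟩ := hper.exists_mem_Ico (by positivity) s (φ - π)
    refine (hmax hz).trans ?_
    simp only [hst]
    exact hloc φ t ⟨ht.1, by linarith [ht.2]⟩
  have hcc : Continuous c := by
    have h1 := hp.continuous_deriv (by simp)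
    -- Pairing `p'` with `e_{φ + π/2}` isolates the speed, since `sin (π / 2) = 1`.
    have h2 : c = fun φ => bracket (deriv p φ) (eTheta (φ + π / 2)) := by
      funext φ
      rw [hc, bracket_smul_left, bracket_eTheta_eTheta]
      simp
    rw [h2]
    fun_prop
  have hinj : ∀ φ ψ : ℝ, φ < ψ → ψ < φ + 2 * π → p φ ≠ p ψ := by
    intro φ ψ h1 h2 heq
    have hmax : IsLocalMax (fun s => bracket (p s) (eTheta ψ)) φ :=
      Filter.Eventually.of_forall fun s => by simpa only [heq] using hsup ψ _ (hmem s)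
    have h0 := hmax.hasDerivAt_eq_zero (hgd ψ φ)
    have hs : Real.sin (ψ - φ) = 0 := (mul_eq_zero.1 h0).resolve_left (hc0 φ).ne'
    obtain ⟨n, hn⟩ := Real.sin_eq_zero_iff.1 hs
    have hn0 : 0 < n := by
      by_contra hcon
      have : (n : ℝ) ≤ 0 := by exact_mod_cast not_lt.1 hcon
      nlinarith
    have hn1 : n < 2 := by
      by_contra hcon
      have : (2 : ℝ) ≤ n := by exact_mod_cast not_lt.1 hcon
      nlinarith
    obtain rfl : n = 1 := by omega
    -- Opposite outer normals at one point would squeeze `P` into a line.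
    have hψ : ψ = φ + π := by push_cast at hn; linarith
    have he : eTheta ψ = -eTheta φ := by
      rw [hψ]; ext i; fin_cases i <;> simp
    obtain ⟨o, ho⟩ := hint
    obtain ⟨z, hz, hlt⟩ := exists_bracket_lt_of_mem_interior ho (eTheta_ne_zero φ)
    have e1 := hsup φ z hz
    have e2 := hsup ψ o (interior_subset ho)
    rw [he, ← heq, bracket_neg_right, bracket_neg_right] at e2
    linarith
  refine ⟨hzero, p, c, ⟨⟨hd, hc0, hcc, fun u => hasDerivAt_id u, continuous_const⟩, hP.isCompact,
    hP.strictConvex, hint, hrange, hper, ?_, strictMono_id, fun _ => rfl, hsup⟩⟩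
  intro φ hφ ψ hψ h
  rcases lt_trichotomy φ ψ with hlt | heq | hlt
  · exact absurd h (hinj φ ψ hlt (by linarith [hφ.1, hψ.2]))
  · exact heq
  · exact absurd h.symm (hinj ψ φ hlt (by linarith [hψ.1, hφ.2]))

theorem neg_mem_dualBall (hP : ∀ x ∈ P, -x ∈ P) : ∀ y ∈ dualBall P, -y ∈ dualBall P := by
  intro y hy w hw
  have := hy (-w) (hP w hw)
  rw [bracket_neg_left] at this
  rwa [bracket_neg_right]

/-- The dual norm is the support function of `P`: `y / r` lies in the dual ball exactly when `r` is
at least the maximum of `[·, y]` over `P`. -/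
theorem gauge_dualBall {y z : Plane} (hz : z ∈ P) (hmax : ∀ w ∈ P, bracket w y ≤ bracket z y)
    (hpos : 0 < bracket z y) : gauge (dualBall P) y = bracket z y := by
  have hset : {r ∈ Ioi (0 : ℝ) | r⁻¹ • y ∈ dualBall P} = Ici (bracket z y) := by
    ext r
    simp only [mem_Ioi, dualBall, mem_ofPred_eq, mem_Ici, bracket_smul_right]
    constructor
    · rintro ⟨hr, h⟩
      have := h z hz
      rwa [inv_mul_le_iff₀ hr, mul_one] at this
    · intro h
      have hr : 0 < r := hpos.trans_le h
      refine ⟨hr, fun w hw => ?_⟩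
      rw [inv_mul_le_iff₀ hr, mul_one]
      exact (hmax w hw).trans h
  rw [gauge_def', hset, csInf_Ici]

end UnitBall

/-! ### Existence of a largest inscribed ball -/

section Inradius

variable {P K : Set Plane}

theorem vadd_smul_subset_iff {x : Plane} {r : ℝ} :
    x +ᵥ r • P ⊆ K ↔ ∀ w ∈ P, x + r • w ∈ K := by
  constructor
  · exact fun h w hw => h ⟨r • w, smul_mem_smul_set hw, rfl⟩
  · rintro h _ ⟨_, ⟨w, hw, rfl⟩, rfl⟩
    exact h w hw

theorem area_vadd_smul (x : Plane) (r : ℝ) : area (x +ᵥ r • P) = r ^ 2 * area P := by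
  unfold area Measure.real
  rw [measure_vadd, Measure.addHaar_smul, finrank_euclideanSpace, Fintype.card_fin,
    ENNReal.toReal_mul, ENNReal.toReal_ofReal (abs_nonneg _), abs_of_nonneg (sq_nonneg r)]

theorem sq_mul_area_le (hK : IsCompact K) {x : Plane} {r : ℝ} (h : x +ᵥ r • P ⊆ K) :
    r ^ 2 * area P ≤ area K := by
  rw [← area_vadd_smul x r]
  exact measureReal_mono h hK.measure_lt_top.ne

/-- The set is the projection of a compact set of pairs (radius, centre): centres lie in `K` because
`0 ∈ P`, and areas bound the radii. The bound `R` uses `r ≤ 1 + r²`. -/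
theorem isCompact_setOf_radius (hK : IsCompact K) (h0 : (0 : Plane) ∈ P) (hP : 0 < area P) :
    IsCompact {r : ℝ | 0 ≤ r ∧ ∃ x : Plane, x +ᵥ r • P ⊆ K} := by
  set R := 1 + area K / area P
  have hR : ∀ r : ℝ, 0 ≤ r → ∀ x : Plane, x +ᵥ r • P ⊆ K → r ≤ R := by
    intro r hr x hx
    have h1 := sq_mul_area_le hK hx
    have h2 : r ^ 2 ≤ area K / area P := (le_div_iff₀ hP).2 h1
    have : R = 1 + area K / area P := rfl
    nlinarith [sq_nonneg (r - 1)]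
  have hcl : IsClosed {q : ℝ × Plane | ∀ w ∈ P, q.2 + q.1 • w ∈ K} := by
    simp only [ofPred_forall]
    exact isClosed_biInter fun w _ => hK.isClosed.preimage (by fun_prop)
  have hcomp := ((isCompact_Icc (a := 0) (b := R)).prod hK).inter_right hcl
  convert hcomp.image continuous_fst using 1
  ext r
  simp only [mem_ofPred_eq, vadd_smul_subset_iff, mem_image, mem_inter_iff, mem_prod, Prod.exists,
    exists_and_right, exists_eq_right]
  constructor
  · rintro ⟨hr, x, hx⟩
    refine ⟨x, ⟨⟨hr, hR r hr x (vadd_smul_subset_iff.2 hx)⟩, ?_⟩, hx⟩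
    simpa using hx 0 h0
  · rintro ⟨x, ⟨⟨hr, -⟩, -⟩, hx⟩
    exact ⟨hr, x, hx⟩

theorem exists_pos_radius (hPc : IsCompact P) (hint : (interior K).Nonempty) :
    ∃ r : ℝ, 0 < r ∧ ∃ x : Plane, x +ᵥ r • P ⊆ K := by
  obtain ⟨o, ho⟩ := hint
  obtain ⟨ε, hε, hball⟩ := Metric.mem_nhds_iff.1 (mem_interior_iff_mem_nhds.1 ho)
  obtain ⟨M, hM0, hM⟩ := hPc.isBounded.exists_pos_norm_le
  refine ⟨ε / (2 * M), by positivity, o, vadd_smul_subset_iff.2 fun w hw => hball ?_⟩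
  rw [mem_ball_iff_norm, add_sub_cancel_left, norm_smul, Real.norm_of_nonneg (by positivity)]
  calc ε / (2 * M) * ‖w‖ ≤ ε / (2 * M) * M := by gcongr; exact hM w hw
    _ = ε / 2 := by field_simp
    _ < ε := by linarith

/-- The inradius is positive and attained. -/
theorem inradius_spec (hK : IsCompact K) (hint : (interior K).Nonempty) (hPc : IsCompact P)
    (h0 : (0 : Plane) ∈ P) (hP : 0 < area P) :
    0 < inradius P K ∧ (∃ x : Plane, x +ᵥ inradius P K • P ⊆ K) ∧
      ∀ r : ℝ, 0 ≤ r → ∀ x : Plane, x +ᵥ r • P ⊆ K → r ≤ inradius P K := by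
  have hc := isCompact_setOf_radius hK h0 hP
  obtain ⟨r, hr, x, hx⟩ := exists_pos_radius hPc hint
  have hmax : ∀ r : ℝ, 0 ≤ r → ∀ x : Plane, x +ᵥ r • P ⊆ K → r ≤ inradius P K :=
    fun r hr x hx => le_csSup hc.bddAbove ⟨hr, x, hx⟩
  exact ⟨hr.trans_le (hmax r hr.le x hx), (hc.sSup_mem ⟨r, hr.le, x, hx⟩).2, hmax⟩

end Inradius

/-! ### The Bonnesen functional as a Wirtinger functional -/

section Gap

variable {P K : Set Plane} {γ p : ℝ → Plane} {ρ θ θ' c : ℝ → ℝ} {x : Plane} {r : ℝ}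

/-- The vector from the point of `x + r P` to the point of the curve `γ` that have the same outer
normal. -/
def gap (γ p : ℝ → Plane) (θ : ℝ → ℝ) (x : Plane) (r : ℝ) (u : ℝ) : Plane :=
  γ u - x - r • p (θ u)

/-- The normal component of `gap`: the difference of the support functions. -/
noncomputable def normalGap (γ p : ℝ → Plane) (θ : ℝ → ℝ) (x : Plane) (r : ℝ) (u : ℝ) : ℝ :=
  bracket (gap γ p θ x r u) (eTheta (θ u))

/-- The tangential component of `gap`. -/
noncomputable def tangentGap (γ p : ℝ → Plane) (θ : ℝ → ℝ) (x : Plane) (r : ℝ) (u : ℝ) : ℝ :=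
  bracket (gap γ p θ x r u) (eTheta (θ u + π / 2))

theorem hasDerivAt_bracket {f g : ℝ → Plane} {f' g' : Plane} {u : ℝ} (hf : HasDerivAt f f' u)
    (hg : HasDerivAt g g' u) :
    HasDerivAt (fun s => bracket (f s) (g s)) (bracket f' (g u) + bracket (f u) g') u := by
  unfold bracket
  refine (((hasDerivAt_apply hf 0).fun_mul (hasDerivAt_apply hg 1)).fun_sub
    ((hasDerivAt_apply hf 1).fun_mul (hasDerivAt_apply hg 0))).congr_deriv ?_
  ring

theorem hasDerivAt_eTheta {θ : ℝ → ℝ} {y u : ℝ} (hθ : HasDerivAt θ y u) :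
    HasDerivAt (fun s => eTheta (θ s)) (y • eTheta (θ u + π / 2)) u := by
  have he : (fun s => eTheta (θ s)) = fun s => (-Real.sin (θ s)) • EuclideanSpace.single 0 (1 : ℝ) +
      Real.cos (θ s) • EuclideanSpace.single 1 (1 : ℝ) := by
    funext s
    ext i
    fin_cases i <;> simp
  rw [he]
  refine ((hθ.sin.neg.smul_const _).add (hθ.cos.smul_const _)).congr_deriv ?_
  ext i
  fin_cases i <;> simp [Real.sin_add_pi_div_two, Real.cos_add_pi_div_two] <;> ring

theorem hasDerivAt_comp_angle (hP : IsBoundaryAngle P p c id fun _ => 1)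
    (hK : IsBoundaryAngle K γ ρ θ θ') (u : ℝ) :
    HasDerivAt (fun s => p (θ s)) ((c (θ u) * θ' u) • eTheta (θ u)) u := by
  refine ((hP.hasDerivAt (θ u)).scomp u (hK.hasDerivAt_angle u)).congr_deriv ?_
  rw [smul_smul, mul_comm]; rfl

theorem hasDerivAt_gap (hP : IsBoundaryAngle P p c id fun _ => 1)
    (hK : IsBoundaryAngle K γ ρ θ θ') (u : ℝ) :
    HasDerivAt (gap γ p θ x r) ((ρ u - r * (c (θ u) * θ' u)) • eTheta (θ u)) u := by
  refine (((hK.hasDerivAt u).sub_const x).sub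
    ((hasDerivAt_comp_angle hP hK u).const_smul r)).congr_deriv ?_
  rw [smul_smul, ← sub_smul]

/-- Points with equal normals have parallel tangents, so the gap moves along `e_θ` and only the
rotation of `e_θ` contributes. -/
theorem hasDerivAt_normalGap (hP : IsBoundaryAngle P p c id fun _ => 1)
    (hK : IsBoundaryAngle K γ ρ θ θ') (u : ℝ) :
    HasDerivAt (normalGap γ p θ x r) (tangentGap γ p θ x r u * θ' u) u := by
  refine (hasDerivAt_bracket (hasDerivAt_gap hP hK u)
    (hasDerivAt_eTheta (hK.hasDerivAt_angle u))).congr_deriv ?_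
  rw [bracket_smul_left, bracket_eTheta_eTheta, bracket_smul_right, tangentGap]
  simp [mul_comm]

theorem hasDerivAt_tangentGap (hP : IsBoundaryAngle P p c id fun _ => 1)
    (hK : IsBoundaryAngle K γ ρ θ θ') (u : ℝ) :
    HasDerivAt (tangentGap γ p θ x r)
      (ρ u - r * (c (θ u) * θ' u) - normalGap γ p θ x r u * θ' u) u := by
  refine (hasDerivAt_bracket (hasDerivAt_gap hP hK u)
    (hasDerivAt_eTheta ((hK.hasDerivAt_angle u).add_const (π / 2)))).congr_deriv ?_
  have he : eTheta (θ u + π / 2 + π / 2) = -eTheta (θ u) := by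
    rw [add_assoc, add_halves]
    ext i
    fin_cases i <;> simp
  rw [bracket_smul_left, bracket_eTheta_eTheta, bracket_smul_right, he, bracket_neg_right,
    normalGap]
  simp
  ring

theorem gap_periodic (hP : IsBoundaryAngle P p c id fun _ => 1)
    (hK : IsBoundaryAngle K γ ρ θ θ') : Periodic (gap γ p θ x r) (2 * π) := by
  intro u
  simp only [gap, hK.periodic u, hK.angle_add, hP.periodic (θ u)]

theorem normalGap_periodic (hP : IsBoundaryAngle P p c id fun _ => 1)
    (hK : IsBoundaryAngle K γ ρ θ θ') : Periodic (normalGap γ p θ x r) (2 * π) := by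
  intro u
  simp only [normalGap, gap_periodic hP hK u]
  rw [show eTheta (θ (u + 2 * π)) = eTheta (θ u) from hK.eTheta_periodic u]

theorem tangentGap_periodic (hP : IsBoundaryAngle P p c id fun _ => 1)
    (hK : IsBoundaryAngle K γ ρ θ θ') : Periodic (tangentGap γ p θ x r) (2 * π) := by
  intro u
  simp only [tangentGap, gap_periodic hP hK u]
  rw [hK.angle_add, add_right_comm,
    (eTheta_eq_iff (φ := θ u + π / 2 + 2 * π) (θ := θ u + π / 2)).2 ⟨1, by simp⟩]

theorem continuous_normalGap (hP : IsBoundaryAngle P p c id fun _ => 1)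
    (hK : IsBoundaryAngle K γ ρ θ θ') : Continuous (normalGap γ p θ x r) :=
  continuous_iff_continuousAt.2 fun u => (hasDerivAt_normalGap hP hK u).continuousAt

theorem continuous_tangentGap (hP : IsBoundaryAngle P p c id fun _ => 1)
    (hK : IsBoundaryAngle K γ ρ θ θ') : Continuous (tangentGap γ p θ x r) :=
  continuous_iff_continuousAt.2 fun u => (hasDerivAt_tangentGap hP hK u).continuousAt

/-- The substitution `φ = θ u` brings the area of `P` to the parameter of `γ`. -/
theorem area_eq_comp_angle (hP : IsBoundaryAngle P p c id fun _ => 1)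
    (hK : IsBoundaryAngle K γ ρ θ θ') :
    area P = 1 / 2 * ∫ u in (0 : ℝ)..(2 * π),
      c (θ u) * bracket (p (θ u)) (eTheta (θ u)) * θ' u := by
  have hpc := hP.continuous
  have hcc := hP.continuous_speed
  have hcont : Continuous fun φ => c φ * bracket (p φ) (eTheta φ) := by fun_prop
  have hper : Periodic (fun φ => c φ * bracket (p φ) (eTheta φ)) (2 * π) := by
    intro φ
    simp only [← bracket_smul_right]
    rw [hP.periodic φ, show c (φ + 2 * π) • eTheta (φ + 2 * π) = c φ • eTheta φ from
      hP.deriv_periodic φ]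
  have hsub := intervalIntegral.integral_comp_mul_deriv (a := 0) (b := 2 * π) (f := θ) (f' := θ')
    (fun u _ => hK.hasDerivAt_angle u) hK.continuous_deriv_angle.continuousOn hcont
  have h2 := hK.angle_add 0
  rw [zero_add] at h2
  simp only [comp_apply] at hsub
  rw [hsub, h2, hper.intervalIntegral_add_eq (θ 0) 0, zero_add, hP.area_eq 0]
  simp only [bracket_smul_right, sub_zero, id]

theorem length_eq (hP : IsBoundaryAngle P p c id fun _ => 1) (h0 : (0 : Plane) ∈ interior P)
    (hK : IsBoundaryAngle K γ ρ θ θ') :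
    length (dualBall P) γ =
      ∫ u in (0 : ℝ)..(2 * π), ρ u * bracket (p (θ u)) (eTheta (θ u)) := by
  unfold length
  refine intervalIntegral.integral_congr fun u _ => ?_
  have hsup := hP.support (θ u)
  have hpos := hP.bracket_sub_pos h0 (θ u)
  simp only [id, sub_zero] at hsup hpos
  rw [(hK.hasDerivAt u).deriv, gauge_dualBall (hP.mem (θ u)), bracket_smul_right]
  · intro w hw
    rw [bracket_smul_right, bracket_smul_right]
    exact mul_le_mul_of_nonneg_left (hsup w hw) (hK.pos u).le
  · rw [bracket_smul_right]
    exact mul_pos (hK.pos u) hpos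

/-- The Bonnesen functional as the Wirtinger functional of the difference of the support
functions. -/
theorem bonnesen_eq (hP : IsBoundaryAngle P p c id fun _ => 1) (h0 : (0 : Plane) ∈ interior P)
    (hK : IsBoundaryAngle K γ ρ θ θ') (x : Plane) (r : ℝ) :
    r * length (dualBall P) γ - area K - area P * r ^ 2 =
      1 / 2 * ∫ u in (0 : ℝ)..(2 * π),
        (tangentGap γ p θ x r u ^ 2 - normalGap γ p θ x r u ^ 2) * θ' u := by
  have hγc := hK.continuous
  have hpc := hP.continuous
  have hcc := hP.continuous_speed
  have hρc := hK.continuous_speed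
  have hθc := hK.continuous_angle
  have hθ'c := hK.continuous_deriv_angle
  have hnc : Continuous (normalGap γ p θ x r) := continuous_normalGap hP hK
  have htc : Continuous (tangentGap γ p θ x r) := continuous_tangentGap hP hK
  set h := normalGap γ p θ x r with hh
  set k := tangentGap γ p θ x r with hk
  -- The two integrands differ by the derivative of a periodic function, which integrates to zero.
  have hG : ∀ u, HasDerivAt
      (fun s => 1 / 2 * (r * bracket (p (θ s)) (gap γ p θ x r s) - h s * k s))
      (r * (ρ u * bracket (p (θ u)) (eTheta (θ u)))
        - 1 / 2 * bracket (γ u - x) (ρ u • eTheta (θ u))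
        - r ^ 2 * (1 / 2) * (c (θ u) * bracket (p (θ u)) (eTheta (θ u)) * θ' u)
        - 1 / 2 * ((k u ^ 2 - h u ^ 2) * θ' u)) u := by
    intro u
    have h1 := (hasDerivAt_bracket (hasDerivAt_comp_angle hP hK u)
      (hasDerivAt_gap (x := x) (r := r) hP hK u)).const_mul r
    have h2 := (hasDerivAt_normalGap (x := x) (r := r) hP hK u).fun_mul
      (hasDerivAt_tangentGap (x := x) (r := r) hP hK u)
    refine ((h1.fun_sub h2).const_mul (1 / 2)).congr_deriv ?_
    have e1 : bracket ((c (θ u) * θ' u) • eTheta (θ u)) (gap γ p θ x r u) =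
        -(c (θ u) * θ' u * h u) := by
      simp only [hh, normalGap, bracket, PiLp.smul_apply, smul_eq_mul]; ring
    have e2 : bracket (γ u - x) (ρ u • eTheta (θ u)) =
        ρ u * (h u + r * bracket (p (θ u)) (eTheta (θ u))) := by
      simp only [hh, normalGap, gap, bracket, PiLp.smul_apply, PiLp.sub_apply, smul_eq_mul]; ring
    rw [e1, e2, bracket_smul_right, ← hh, ← hk]
    ring
  have hint := intervalIntegral.integral_eq_sub_of_hasDerivAt (a := 0) (b := 2 * π)
    (fun u _ => hG u) ((by fun_prop : Continuous _).intervalIntegrable _ _)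
  have hp1 := normalGap_periodic (x := x) (r := r) hP hK 0
  have hp2 := tangentGap_periodic (x := x) (r := r) hP hK 0
  have hp3 := gap_periodic (x := x) (r := r) hP hK 0
  have hp4 := hP.periodic (θ 0)
  have hp5 := hK.angle_add 0
  rw [zero_add] at hp1 hp2 hp3 hp5
  rw [hp5, hp4, hp3, hh, hk, hp1, hp2, sub_self, ← hh, ← hk,
    intervalIntegral.integral_sub ((by fun_prop : Continuous _).intervalIntegrable _ _)
      ((by fun_prop : Continuous _).intervalIntegrable _ _),
    intervalIntegral.integral_sub ((by fun_prop : Continuous _).intervalIntegrable _ _)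
      ((by fun_prop : Continuous _).intervalIntegrable _ _),
    intervalIntegral.integral_sub ((by fun_prop : Continuous _).intervalIntegrable _ _)
      ((by fun_prop : Continuous _).intervalIntegrable _ _)] at hint
  simp only [intervalIntegral.integral_const_mul] at hint
  have hA := hK.area_eq x
  have hAP := area_eq_comp_angle hP hK
  rw [length_eq hP h0 hK, hA, hAP]
  linarith

end Gap

/-! ### Contact points and the case of equality -/

section Contact

variable {P K : Set Plane} {γ p : ℝ → Plane} {ρ θ θ' c : ℝ → ℝ} {x : Plane} {r : ℝ}

theorem normalGap_eq (u : ℝ) : normalGap γ p θ x r u =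
    bracket (γ u) (eTheta (θ u)) - bracket x (eTheta (θ u)) -
      r * bracket (p (θ u)) (eTheta (θ u)) := by
  simp only [normalGap, gap, bracket_sub_left, bracket_smul_left]

theorem normalGap_nonneg (hP : IsBoundaryAngle P p c id fun _ => 1)
    (hK : IsBoundaryAngle K γ ρ θ θ') (hsub : x +ᵥ r • P ⊆ K) (u : ℝ) :
    0 ≤ normalGap γ p θ x r u := by
  have h := hK.support u _ (vadd_smul_subset_iff.1 hsub _ (hP.mem (θ u)))
  rw [bracket_add_left, bracket_smul_left] at h
  rw [normalGap_eq]
  linarith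

/-- The point `x + r p(θ)` of `K` then lies on the support line at `γ u`, which meets `K` only
there. -/
theorem gap_eq_zero (hP : IsBoundaryAngle P p c id fun _ => 1)
    (hK : IsBoundaryAngle K γ ρ θ θ') (hsub : x +ᵥ r • P ⊆ K) {u : ℝ}
    (h : normalGap γ p θ x r u = 0) : gap γ p θ x r u = 0 := by
  have h1 := hK.eq_of_bracket_eq (u := u) (vadd_smul_subset_iff.1 hsub _ (hP.mem (θ u))) (by
    rw [normalGap_eq] at h
    rw [bracket_add_left, bracket_smul_left]
    linarith)
  rw [gap, ← h1]
  abel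

/-- A translate of `r P` inside `K` with `r` maximal touches the boundary of `K` in every closed
half plane. -/
theorem exists_contact (hP : IsBoundaryAngle P p c id fun _ => 1) (h0 : (0 : Plane) ∈ interior P)
    (hK : IsBoundaryAngle K γ ρ θ θ') (hr : 0 ≤ r) (hsub : x +ᵥ r • P ⊆ K)
    (hmax : ∀ s : ℝ, 0 ≤ s → ∀ y : Plane, y +ᵥ s • P ⊆ K → s ≤ r) (w : Plane) :
    ∃ u, normalGap γ p θ x r u = 0 ∧ 0 ≤ bracket w (eTheta (θ u)) := by
  by_contra! hcon
  have hpc := hP.continuous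
  have hθc := hK.continuous_angle
  have hh : Continuous (normalGap γ p θ x r) := continuous_normalGap hP hK
  set h := normalGap γ p θ x r with hhdef
  have hhn : ∀ u, 0 ≤ h u := normalGap_nonneg hP hK hsub
  set g : ℝ → ℝ := fun u => bracket w (eTheta (θ u)) with hg
  have hgc : Continuous g := by fun_prop
  set H : ℝ → ℝ := fun u => bracket (p (θ u)) (eTheta (θ u)) with hH
  have hHc : Continuous H := by fun_prop
  have hH0 : ∀ u, 0 < H u := fun u => by
    have := hP.bracket_sub_pos h0 (θ u)
    rwa [sub_zero] at this
  -- Moving the copy by `ε w` changes `h` into `h - ε g`. Where `g < 0` any `ε` keeps this positive;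
  -- the compact rest contains no contact, so `h` has a positive minimum there.
  obtain ⟨ε, -, hε⟩ : ∃ ε > 0, ∀ u ∈ Icc 0 (2 * π), 0 < h u - ε * g u := by
    have hA : IsCompact (Icc 0 (2 * π) ∩ {u | 0 ≤ g u}) :=
      isCompact_Icc.inter_right (isClosed_le continuous_const hgc)
    obtain ⟨M, hM⟩ := (isCompact_Icc (a := 0) (b := 2 * π)).exists_bound_of_continuousOn
      hgc.continuousOn
    have hneg : ∀ ε > 0, ∀ u, g u < 0 → 0 < h u - ε * g u := fun ε hε u hu => by
      nlinarith [hhn u, mul_pos hε (neg_pos.2 hu)]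
    rcases (Icc 0 (2 * π) ∩ {u | 0 ≤ g u}).eq_empty_or_nonempty with he | hne
    · refine ⟨1, one_pos, fun u hu => hneg 1 one_pos u ?_⟩
      by_contra hgu
      exact (he ▸ (⟨hu, not_lt.1 hgu⟩ : u ∈ Icc 0 (2 * π) ∩ {u | 0 ≤ g u}) : u ∈ (∅ : Set ℝ))
    · obtain ⟨v, hv, hmin⟩ := hA.exists_isMinOn hne hh.continuousOn
      have hhv : 0 < h v := (hhn v).lt_of_ne fun h0 => not_le.2 (hcon v h0.symm) hv.2
      have hM0 : 0 ≤ M := (norm_nonneg _).trans (hM v hv.1)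
      refine ⟨h v / (2 * (M + 1)), by positivity, fun u hu => ?_⟩
      rcases lt_or_ge (g u) 0 with hgu | hgu
      · exact hneg _ (by positivity) u hgu
      · have h1 : h v ≤ h u := hmin ⟨hu, hgu⟩
        have h2 : g u ≤ M := (le_abs_self _).trans (hM u hu)
        have h3 : h v / (2 * (M + 1)) * g u ≤ h v / (2 * (M + 1)) * (M + 1) :=
          mul_le_mul_of_nonneg_left (by linarith) (by positivity)
        have h4 : h v / (2 * (M + 1)) * (M + 1) = h v / 2 := by field_simp
        linarith
  -- The minimal ratio `δ` of the new gap to the support function of `P` leaves room for the radius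
  -- `r + δ`, against maximality.
  obtain ⟨v, hv, hmin⟩ := (isCompact_Icc (a := 0) (b := 2 * π)).exists_isMinOn
    ⟨0, le_rfl, by positivity⟩ (f := fun u => (h u - ε * g u) / H u)
    ((by fun_prop : Continuous fun u => h u - ε * g u).div hHc fun u => (hH0 u).ne').continuousOn
  set δ := (h v - ε * g v) / H v with hδ
  have hδ0 : 0 < δ := div_pos (hε v hv) (hH0 v)
  have hδle : ∀ u, δ * H u ≤ h u - ε * g u := by
    have hper : Periodic (fun u => h u - ε * g u - δ * H u) (2 * π) := by
      intro u
      have e1 := normalGap_periodic (x := x) (r := r) hP hK u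
      have e2 : eTheta (θ (u + 2 * π)) = eTheta (θ u) := hK.eTheta_periodic u
      simp only [hg, hH, hhdef, e1, e2]
      rw [hK.angle_add, hP.periodic]
    intro u
    obtain ⟨s, hs, hus⟩ := hper.exists_mem_Ico₀ (by positivity) u
    have h1 : δ ≤ (h s - ε * g s) / H s := hmin ⟨hs.1, hs.2.le⟩
    rw [le_div_iff₀ (hH0 s)] at h1
    linarith
  have hnew : (x + ε • w) +ᵥ (r + δ) • P ⊆ K := by
    refine vadd_smul_subset_iff.2 fun y hy => hK.mem_of_forall_le fun u => ?_
    have h1 : bracket y (eTheta (θ u)) ≤ H u := hP.support (θ u) y hy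
    have h2 := mul_le_mul_of_nonneg_left h1 (by linarith : 0 ≤ r + δ)
    have h3 := hδle u
    rw [hhdef, normalGap_eq] at h3
    rw [bracket_add_left, bracket_add_left, bracket_smul_left, bracket_smul_left]
    simp only [hg] at h3
    have h4 : (r + δ) * H u = r * bracket (p (θ u)) (eTheta (θ u)) + δ * H u := by ring
    linarith
  have := hmax _ (by linarith) _ hnew
  linarith

/-- A closed periodic set of angles that meets every closed half circle divides the circle into
at most three arcs of length at most `π`. -/
theorem exists_three_arcs {h : ℝ → ℝ} (hh : Continuous h) (hper : Periodic h (2 * π))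
    (hθc : Continuous θ) (hmono : StrictMono θ) (hadd : ∀ u, θ (u + 2 * π) = θ u + 2 * π)
    (hhit : ∀ ψ, ∃ u, h u = 0 ∧ 0 ≤ Real.cos (θ u - ψ)) :
    ∃ t a b, (t ≤ a ∧ a ≤ b ∧ b ≤ t + 2 * π) ∧ (h t = 0 ∧ h a = 0 ∧ h b = 0) ∧
      θ a ≤ θ t + π ∧ θ b ≤ θ a + π ∧ θ (t + 2 * π) ≤ θ b + π := by
  have hpi := Real.pi_pos
  obtain ⟨t, ht, -⟩ := hhit 0
  have hA : IsCompact (Icc t (t + 2 * π) ∩ {u | h u = 0 ∧ θ u ≤ θ t + π}) :=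
    isCompact_Icc.inter_right
      ((isClosed_eq hh continuous_const).inter (isClosed_le hθc continuous_const))
  have hB : IsCompact (Icc t (t + 2 * π) ∩ {u | h u = 0 ∧ θ t + π ≤ θ u}) :=
    isCompact_Icc.inter_right
      ((isClosed_eq hh continuous_const).inter (isClosed_le continuous_const hθc))
  -- `a` is the last zero up to the direction opposite to `t`, and `b` the first zero from it on;
  -- only the arc from `a` to `b` could exceed `π`.
  obtain ⟨a, ⟨ha, ha0, haθ⟩, hamax⟩ :=
    hA.exists_isGreatest ⟨t, ⟨le_rfl, by linarith⟩, ht, by linarith⟩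
  obtain ⟨b, ⟨hb, hb0, hbθ⟩, hbmin⟩ := hB.exists_isLeast
    ⟨t + 2 * π, ⟨by linarith, le_rfl⟩, by rw [hper, ht], by rw [hadd]; linarith⟩
  refine ⟨t, a, b, ⟨ha.1, hmono.le_iff_le.1 (haθ.trans hbθ), hb.2⟩, ⟨ht, ha0, hb0⟩, haθ, ?_,
    by rw [hadd]; linarith⟩
  by_contra! hgap
  -- Were that arc longer than `π`, the closed half circle about its middle would lie strictly
  -- between `a` and `b` and contain no zero.
  set ψ := (θ a + θ b) / 2 with hψ
  obtain ⟨u', hu0', hcos'⟩ := hhit ψ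
  have hper2 : Periodic (fun u => (h u, Real.cos (θ u - ψ))) (2 * π) := by
    intro u
    simp only [hper u, hadd, add_sub_right_comm, Real.cos_add_two_pi]
  obtain ⟨u, hu, he⟩ := hper2.exists_mem_Ico (by positivity) u' t
  have hu0 : h u = 0 := (congrArg Prod.fst he).symm.trans hu0'
  have hcos : 0 ≤ Real.cos (θ u - ψ) :=
    hcos'.trans_eq (congrArg Prod.snd he)
  have h1 : θ t ≤ θ u := hmono.monotone hu.1
  have h2 : θ u < θ t + 2 * π := by rw [← hadd]; exact hmono hu.2
  have h3 : θ t ≤ θ a := hmono.monotone ha.1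
  have h4 : θ b ≤ θ t + 2 * π := by rw [← hadd]; exact hmono.monotone hb.2
  have hua : a < u := by
    by_contra! hcon
    have := hmono.monotone hcon
    rw [← Real.cos_neg] at hcos
    exact absurd hcos (not_le.2 (Real.cos_neg_of_pi_div_two_lt_of_lt (by linarith) (by linarith)))
  have hub : u < b := by
    by_contra! hcon
    have := hmono.monotone hcon
    exact absurd hcos (not_le.2 (Real.cos_neg_of_pi_div_two_lt_of_lt (by linarith) (by linarith)))
  rcases le_total (θ u) (θ t + π) with hle | hle
  · exact absurd (hamax ⟨⟨hu.1, hu.2.le⟩, hu0, hle⟩) (not_le.2 hua)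
  · exact absurd (hbmin ⟨⟨hu.1, hu.2.le⟩, hu0, hle⟩) (not_le.2 hub)

/-- The arcs between contacts may degenerate to points. -/
theorem wirtinger_of_le {h k : ℝ → ℝ} {a b : ℝ} (hab : a ≤ b)
    (hh : ∀ u, HasDerivAt h (k u * θ' u) u) (hθ : ∀ u, HasDerivAt θ (θ' u) u)
    (hθ' : Continuous θ') (hmono : StrictMono θ) (hk : Continuous k) (hlen : θ b ≤ θ a + π)
    (hha : h a = 0) (hhb : h b = 0) (hka : k a = 0) :
    0 ≤ ∫ u in a..b, (k u ^ 2 - h u ^ 2) * θ' u ∧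
      (∫ u in a..b, (k u ^ 2 - h u ^ 2) * θ' u = 0 → ∀ u ∈ Icc a b, h u = 0) := by
  rcases hab.eq_or_lt with rfl | hab
  · refine ⟨by simp, fun _ u hu => ?_⟩
    rw [le_antisymm hu.2 hu.1, hha]
  · exact wirtinger hab hh hθ hθ' hmono hk hlen hha hhb hka

/-- The case of equality in Bonnesen's inequality for the inradius. -/
theorem gap_eq_zero_of_bonnesen_eq_zero (hP : IsBoundaryAngle P p c id fun _ => 1)
    (h0 : (0 : Plane) ∈ interior P) (hK : IsBoundaryAngle K γ ρ θ θ') (hr : 0 ≤ r)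
    (hsub : x +ᵥ r • P ⊆ K) (hmax : ∀ s : ℝ, 0 ≤ s → ∀ y : Plane, y +ᵥ s • P ⊆ K → s ≤ r)
    (heq : r * length (dualBall P) γ - area K - area P * r ^ 2 = 0) (u : ℝ) :
    gap γ p θ x r u = 0 := by
  have hθ'c := hK.continuous_deriv_angle
  have hh : Continuous (normalGap γ p θ x r) := continuous_normalGap hP hK
  have hk : Continuous (tangentGap γ p θ x r) := continuous_tangentGap hP hK
  have hhper : Periodic (normalGap γ p θ x r) (2 * π) := normalGap_periodic hP hK
  have hkper : Periodic (tangentGap γ p θ x r) (2 * π) := tangentGap_periodic hP hK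
  have hd : ∀ u, HasDerivAt (normalGap γ p θ x r) (tangentGap γ p θ x r u * θ' u) u :=
    hasDerivAt_normalGap hP hK
  have hzero : ∀ u, normalGap γ p θ x r u = 0 → tangentGap γ p θ x r u = 0 := fun u hu => by
    rw [tangentGap, gap_eq_zero hP hK hsub hu]
    simp [bracket]
  refine gap_eq_zero hP hK hsub ?_
  rw [bonnesen_eq hP h0 hK x r] at heq
  set h := normalGap γ p θ x r with hhdef
  set k := tangentGap γ p θ x r with hkdef
  obtain ⟨t, a, b, ⟨hta, hab, hbt⟩, ⟨ht0, ha0, hb0⟩, h1, h2, h3⟩ :=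
    exists_three_arcs hh hhper hK.continuous_angle hK.strictMono hK.angle_add fun ψ => by
      obtain ⟨u, hu, hcos⟩ := exists_contact hP h0 hK hr hsub hmax !₂[Real.cos ψ, Real.sin ψ]
      refine ⟨u, hu, ?_⟩
      rw [Real.cos_sub]
      have : bracket !₂[Real.cos ψ, Real.sin ψ] (eTheta (θ u)) =
          Real.cos (θ u) * Real.cos ψ + Real.sin (θ u) * Real.sin ψ := by
        simp [bracket]; ring
      rwa [← this]
  have hfc : Continuous fun u => (k u ^ 2 - h u ^ 2) * θ' u := by fun_prop
  have hθ'per : Periodic θ' (2 * π) := by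
    intro s
    have e1 := (hK.hasDerivAt_angle (s + 2 * π)).comp_add_const s (2 * π)
    rw [show (fun s => θ (s + 2 * π)) = fun s => θ s + 2 * π from funext hK.angle_add] at e1
    exact e1.unique ((hK.hasDerivAt_angle s).add_const _)
  have hfper : Periodic (fun u => (k u ^ 2 - h u ^ 2) * θ' u) (2 * π) := by
    intro s
    simp only [hkper s, hhper s, hθ'per s]
  have hshift := hfper.intervalIntegral_add_eq 0 t
  rw [zero_add] at hshift
  have hW : ∀ s v, s ≤ v → h s = 0 → h v = 0 → θ v ≤ θ s + π → _ := fun s v hsv hs hv hlen =>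
    wirtinger_of_le hsv hd hK.hasDerivAt_angle hθ'c hK.strictMono hk hlen hs hv (hzero s hs)
  obtain ⟨n1, z1⟩ := hW t a hta ht0 ha0 h1
  obtain ⟨n2, z2⟩ := hW a b hab ha0 hb0 h2
  obtain ⟨n3, z3⟩ := hW b (t + 2 * π) hbt hb0 (by rw [hhper, ht0]) h3
  -- Three nonnegative integrals with sum zero all vanish, so equality holds on every arc.
  have hsum1 := intervalIntegral.integral_add_adjacent_intervals
    (hfc.intervalIntegrable (μ := volume) t a) (hfc.intervalIntegrable a b)
  have hsum2 := intervalIntegral.integral_add_adjacent_intervals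
    (hfc.intervalIntegrable (μ := volume) t b) (hfc.intervalIntegrable b (t + 2 * π))
  have hcover : ∀ v ∈ Ico t (t + 2 * π), h v = 0 := by
    intro v hv
    rcases le_total v a with hva | hva
    · exact z1 (by linarith) v ⟨hv.1, hva⟩
    rcases le_total v b with hvb | hvb
    · exact z2 (by linarith) v ⟨hva, hvb⟩
    · exact z3 (by linarith) v ⟨hvb, hv.2.le⟩
  obtain ⟨v, hv, huv⟩ := hhper.exists_mem_Ico (by positivity) u t
  rw [huv, hcover v hv]

theorem range_eq_of_gap_eq_zero (hP : IsBoundaryAngle P p c id fun _ => 1)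
    (hK : IsBoundaryAngle K γ ρ θ θ') (h : ∀ u, gap γ p θ x r u = 0) :
    range γ = x +ᵥ r • frontier P := by
  have hγ : ∀ u, γ u = x + r • p (θ u) := by
    intro u
    have := h u
    rw [gap, sub_eq_zero, sub_eq_iff_eq_add] at this
    rw [this, add_comm]
  rw [← hP.range_eq]
  ext z
  constructor
  · rintro ⟨u, rfl⟩
    exact ⟨r • p (θ u), smul_mem_smul_set (mem_range_self _), (hγ u).symm⟩
  · rintro ⟨_, ⟨_, ⟨φ, rfl⟩, rfl⟩, rfl⟩
    obtain ⟨u, hu⟩ := hK.exists_angle_eq φ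
    refine ⟨u, ?_⟩
    have : p (θ u) = p φ := hP.eq_of_bracket_eq (u := φ) (hP.mem _) <| by
      have e1 := hP.support (θ u) (p φ) (hP.mem φ)
      have e2 := hP.support φ (p (θ u)) (hP.mem _)
      simp only [id, hu] at e1 e2 ⊢
      exact le_antisymm e2 e1
    rw [hγ, this]
    rfl

/-- Equal bodies have equal support functions, so the normal gap, and then the whole gap, is zero.
-/
theorem bonnesen_eq_zero_of_eq_vadd_smul (hP : IsBoundaryAngle P p c id fun _ => 1)
    (h0 : (0 : Plane) ∈ interior P) (hK : IsBoundaryAngle K γ ρ θ θ') (hr : 0 ≤ r)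
    (hKP : K = x +ᵥ r • P) :
    r * length (dualBall P) γ - area K - area P * r ^ 2 = 0 := by
  have hgap : ∀ u, gap γ p θ x r u = 0 := by
    intro u
    have hsub : x +ᵥ r • P ⊆ K := hKP.ge
    refine gap_eq_zero hP hK hsub (le_antisymm ?_ (normalGap_nonneg hP hK hsub u))
    obtain ⟨_, ⟨w, hw, rfl⟩, hγ⟩ := hKP ▸ hK.mem u
    have hγ' : γ u = x + r • w := hγ.symm
    have := mul_le_mul_of_nonneg_left (hP.support (θ u) w hw) hr
    rw [normalGap_eq, hγ', bracket_add_left, bracket_smul_left]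
    simp only [id] at this
    linarith
  rw [bonnesen_eq hP h0 hK x r]
  have h1 : ∀ u, normalGap γ p θ x r u = 0 := fun u => by
    rw [normalGap, hgap]; simp [bracket]
  have h2 : ∀ u, tangentGap γ p θ x r u = 0 := fun u => by
    rw [tangentGap, hgap]; simp [bracket]
  simp [h1, h2]

end Contact

/-! ### From the boundary back to the body, and the theorem -/

theorem convexHull_frontier {P : Set Plane} (hc : Convex ℝ P) (hP : IsCompact P)
    (h0 : (0 : Plane) ∈ interior P) : convexHull ℝ (frontier P) = P := by
  refine Subset.antisymm (convexHull_min hP.isClosed.frontier_subset hc) fun z hz => ?_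
  have hn : P ∈ nhds 0 := mem_interior_iff_mem_nhds.1 h0
  have hray : ∀ v : Plane, v ≠ 0 → (gauge P v)⁻¹ • v ∈ convexHull ℝ (frontier P) := fun v hv =>
    subset_convexHull ℝ _ (inv_gauge_smul_mem_frontier hc hP hn hv)
  have hconv := convex_convexHull ℝ (frontier P)
  have hzero : (0 : Plane) ∈ convexHull ℝ (frontier P) := by
    have hv : eTheta 0 ≠ 0 := eTheta_ne_zero 0
    have hp := gauge_pos_of_isCompact hP hn hv
    have hq := gauge_pos_of_isCompact hP hn (neg_ne_zero.2 hv)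
    have := hconv (hray _ hv) (hray _ (neg_ne_zero.2 hv))
      -- Weights proportional to the gauges make the two opposite boundary points cancel.
      (a := gauge P (eTheta 0) / (gauge P (eTheta 0) + gauge P (-eTheta 0)))
      (b := gauge P (-eTheta 0) / (gauge P (eTheta 0) + gauge P (-eTheta 0)))
      (by positivity) (by positivity) (by field_simp)
    convert this using 1
    rw [smul_smul, smul_smul, smul_neg, ← sub_eq_add_neg, ← sub_smul]
    field_simp
    simp
  rcases eq_or_ne z 0 with rfl | hz0
  · exact hzero
  have hp := gauge_pos_of_isCompact hP hn hz0
  have hg : gauge P z ≤ 1 := gauge_le_one_of_mem hz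
  have := hconv hzero (hray z hz0) (sub_nonneg.2 hg) hp.le (by ring)
  rwa [smul_zero, zero_add, smul_smul, mul_inv_cancel₀ hp.ne', one_smul] at this

end MinkowskiPlane

theorem lemma2 (P : Set MinkowskiPlane.Plane) (hP : MinkowskiPlane.IsSmoothUnitBall P)
    (γ : ℝ → MinkowskiPlane.Plane) (hγ : MinkowskiPlane.IsStrictlyConvexCurve γ) :
    MinkowskiPlane.inradius P (MinkowskiPlane.region γ) *
            MinkowskiPlane.length (MinkowskiPlane.dualBall P) γ
          - MinkowskiPlane.area (MinkowskiPlane.region γ)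
          - MinkowskiPlane.area P *
            MinkowskiPlane.inradius P (MinkowskiPlane.region γ) ^ 2 = 0 ↔
      MinkowskiPlane.IsHomotheticToCircle P (Set.range γ) := by
  open MinkowskiPlane in
  obtain ⟨h0, p, c, hp⟩ := hP.exists_isBoundaryAngle
  obtain ⟨η, ρ, θ, θ', hη, hrange, hlen⟩ := exists_isBoundaryAngle_of_curve hγ
  obtain ⟨hpos, ⟨x, hx⟩, hmax⟩ := inradius_spec hη.isCompact hη.interior_nonempty hp.isCompact
    (interior_subset h0) hp.area_pos
  rw [← hlen _ (neg_mem_dualBall hP.symmetric)]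
  constructor
  · intro heq
    refine ⟨x, _, hpos, ?_⟩
    rw [← hrange]
    exact range_eq_of_gap_eq_zero hp hη
      (gap_eq_zero_of_bonnesen_eq_zero hp h0 hη hpos.le hx hmax heq)
  · rintro ⟨y, t, ht, hy⟩
    have hK : region γ = y +ᵥ t • P := by
      rw [region, hy, convexHull_vadd, convexHull_smul,
        convexHull_frontier hp.strictConvex.convex hp.isCompact h0]
    have hr : inradius P (region γ) = t := by
      -- The inscribed copy has area at most that of `y + t P`, hence radius at most `t`.
      refine le_antisymm ?_ (hmax t ht.le y hK.ge)
      have h1 := sq_mul_area_le hη.isCompact hx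
      have h2 : area (region γ) = t ^ 2 * area P := by rw [hK, area_vadd_smul]
      rw [h2] at h1
      exact (pow_le_pow_iff_left₀ hpos.le ht.le two_ne_zero).1 (le_of_mul_le_mul_right h1 hp.area_pos)
    rw [hr]
    exact bonnesen_eq_zero_of_eq_vadd_smul hp h0 hη ht.le hK
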